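/- Let $M$ be a smooth Riemannian manifold with distance $d_M$ such that the exponential map is defined on the whole tangent bundle and every pair of points has a logarithm (for all $p,q$ there is $v\in T_pM$ with $\exp_p v=q$ and $\|v\|=d_M(p,q)$). Let $E\subseteq\mathbb R^n$ be closed and convex, and put $d((y,x),(y',x'))^2=d_M(y,y')^2+\|x-x'\|^2$ on $M\times E$. Let $F=(F_M,F_T)$ assign to $z=(y,x)\in M\times E$ a vector $F_M(z)\in T_yM$ and a vector $F_T(z)\in\mathbb R^n$, and let $\mu,L>0$. Assume that for every geodesic $\gamma$ and all $x,x'\in E$, with $z=(\gamma(0),x)$, $z'=(\gamma(1),x')$, $v=\dot\gamma(0)$ and $\Gamma$ the parallel transport along $\gamma$ from $\gamma(1)$ to $\gamma(0)$, $$\langle\Gamma F_M(z')-F_M(z),v\rangle+\langle F_T(z')-F_T(z),x'-x\rangle\ \ge\ \mu\,(\|v\|^2+\|x'-x\|^2),$$ $$\|\Gamma F_M(z')-F_M(z)\|^2+\|F_T(z')-F_T(z)\|^2\ \le\ L^2(\|v\|^2+\|x'-x\|^2)$$ ($F$ is geodesically $\mu$-strongly monotone and $L$-Lipschitz). Let $z^*=(y^*,x^*)\in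 M\times E$ be a solution of the mixed variational inequality: $\langle F_M(z^*),v\rangle+\langle F_T(z^*),x-x^*\rangle\ge0$ for every initial velocity $v\in T_{y^*}M$ of a geodesic issuing from $y^*$ and every $x\in E$. Let $\kappa=\mu/L$, let $N_E(x)=\{c:\langle c,w-x\rangle\le0\ \forall w\in E\}$ be the normal cone, and let $r^{tan}(z)=\min_{c\in N_E(x)}\|F_T(z)+c\|$ for $z=(y,x)$. From a given $z_0=(y_0,x_0)\in M\times E$, stochastic Riemannian gradient descent runs, for $k=0,\dots,K-1$ (with $K\ge1$), $$y_{k+1}=\exp_{y_k}(-\eta_k g_M^{(k)}),\qquad x_{k+1}=\Pi_E(x_k-\eta_k g_T^{(k)}),\qquad \eta_0=\frac1L,\quad \eta_k=\frac{\mu}{L^2}=\frac{\kappa}{L}\ (k\ge1).$$ (a) Deterministic case. If $(g_M^{(k)},g_T^{(k)})=F(z_k)$ for all $k$, then $$r^{tan}(z_K)^2+\|F_M(z_K)\|_{y_K}^2\ \le\ 66\,e^{-\kappa^2(K-1)/2}\,L^2\,d(z_0,z^*)^2 .$$ (b) Stochastic case. Suppose that there is an oracle $(G_M,G_T)(z,\xi)$,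 jointly measurable in $(z,\xi)$, where $\xi$ has a fixed law, which for each fixed $z$ is an unbiased estimator of $F(z)$ with $\mathbb E\big[\|G_M(z,\xi)-F_M(z)\|^2+\|G_T(z,\xi)-F_T(z)\|^2\big]\le\sigma^2$, and that $(g_M^{(k)},g_T^{(k)})$ is the average of $m_k$ answers of the oracle at $z_k$, for independent samples $\xi$ that are independent of the past. Let $B>0$ with $d(z_0,z^*)\le B$, and let the $m_k$ be positive integers with $$m_0\ \ge\ \frac{\sigma^2}{L^2B^2},\qquad m_k\ \ge\ \frac{12\,\sigma^2}{91\,\mu^2\kappa^2B^2}\,e^{\frac{\kappa^2}{4}(k-2)}\quad(1\le k<K).$$ Then $$\mathbb E\left[r^{tan}(z_K)^2+\|F_M(z_K)\|_{y_K}^2\right]\ \le\ 91\,e^{-\kappa^2(K-1)/4}\,L^2B^2 .$$ None of the constants depends on the curvature of $M$. -/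

import Mathlib

open Bundle Manifold MeasureTheory ProbabilityTheory
open scoped ContDiff ENNReal

noncomputable section

/-- Euclidean space `ℝⁿ`. -/
abbrev Euc (n : ℕ) : Type := EuclideanSpace ℝ (Fin n)

section Geometry

variable {d : ℕ} {M : Type*} [MetricSpace M] [ChartedSpace (Euc d) M] [IsManifold (𝓡 d) ∞ M]

/-- Components of a tangent vector in the tangent coordinates of the chart centred at `p`
(meaningful when the base point of the vector lies in the domain of that chart). -/
def tangentCoords (p : M) (v : TangentBundle (𝓡 d) M) : Euc d :=
  (trivializationAt (Euc d) (fun q : M => TangentSpace (𝓡 d) q) p v).2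

variable (d) in
/-- The velocity `γ'(t)` of a curve, as an element of the tangent bundle. -/
def velocity (γ : ℝ → M) (t : ℝ) : TangentBundle (𝓡 d) M :=
  ⟨γ t, mfderiv 𝓘(ℝ, ℝ) (𝓡 d) γ t 1⟩

variable [RiemannianBundle (fun q : M => TangentSpace (𝓡 d) q)]

/-- The metric `g_x(a, b)` in the chart centred at `p`: `x` is a point of the chart's image and
`a`, `b` are component vectors. -/
def chartMetric (p : M) (x a b : Euc d) : ℝ :=
  inner ℝ
    ((trivializationAt (Euc d) (fun q : M => TangentSpace (𝓡 d) q) p).symm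
      ((extChartAt (𝓡 d) p).symm x) a)
    ((trivializationAt (Euc d) (fun q : M => TangentSpace (𝓡 d) q) p).symm
      ((extChartAt (𝓡 d) p).symm x) b)

/-- The derivative at `x`, in the direction `c`, of `x ↦ g_x(a, b)` in the chart centred at `p`. -/
def chartMetricDeriv (p : M) (x c a b : Euc d) : ℝ :=
  fderiv ℝ (fun x' => chartMetric p x' a b) x c

/-- The Christoffel symbols of the first kind of the Levi-Civita connection,
`g(Γ(a, b), c) = (∂_a g(b, c) + ∂_b g(a, c) - ∂_c g(a, b)) / 2`, in the chart centred at `p`. -/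
def christoffelFirst (p : M) (x a b c : Euc d) : ℝ :=
  (chartMetricDeriv p x a b c + chartMetricDeriv p x b a c - chartMetricDeriv p x c a b) / 2

/-- The vector field `V` along the smooth curve `γ` is parallel for the Levi-Civita connection:
`D_t V = 0` at every time `t`, that is, `u' + Γ(γ', u) = 0` for the components `u` of `V` in the
chart centred at `γ t`; the equation is written after pairing with an arbitrary vector `c`. -/
structure IsParallelAlong (γ : ℝ → M) (V : (t : ℝ) → TangentSpace (𝓡 d) (γ t)) : Prop where
  smooth : ContMDiff 𝓘(ℝ, ℝ) (𝓡 d) ∞ γ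
  differentiable : ∀ t : ℝ,
    DifferentiableAt ℝ (fun s => tangentCoords (γ t) (⟨γ s, V s⟩ : TangentBundle (𝓡 d) M)) t
  equation : ∀ (t : ℝ) (c : Euc d),
    chartMetric (γ t) (extChartAt (𝓡 d) (γ t) (γ t))
        (deriv (fun s => tangentCoords (γ t) (⟨γ s, V s⟩ : TangentBundle (𝓡 d) M)) t) c
      + christoffelFirst (γ t) (extChartAt (𝓡 d) (γ t) (γ t))
          (tangentCoords (γ t) (velocity d γ t))
          (tangentCoords (γ t) (⟨γ t, V t⟩ : TangentBundle (𝓡 d) M)) c = 0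

variable (d) in
/-- A (complete, affinely parametrized) geodesic: a smooth curve whose velocity is parallel. -/
def IsGeodesic (γ : ℝ → M) : Prop :=
  IsParallelAlong γ (fun t => (velocity d γ t).2)

/-- `w` is the parallel transport of `v` along `γ` from time `s` to time `t`. -/
def IsParallelTransport (γ : ℝ → M) (s t : ℝ) (v : TangentSpace (𝓡 d) (γ s))
    (w : TangentSpace (𝓡 d) (γ t)) : Prop :=
  ∃ V : (r : ℝ) → TangentSpace (𝓡 d) (γ r), IsParallelAlong γ V ∧ V s = v ∧ V t = w

variable (d M) in
/-- Geodesic completeness: every tangent vector is the initial velocity of a geodesic defined for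
all times, that is, the exponential map is defined on the whole tangent bundle. -/
def GeodesicallyComplete : Prop :=
  ∀ v : TangentBundle (𝓡 d) M, ∃ γ : ℝ → M, IsGeodesic d γ ∧ velocity d γ 0 = v

open scoped Classical in
/-- The exponential map `exp_p v = γ 1`, where `γ` is the geodesic with initial velocity `v`
(the value is irrelevant if there is none). -/
def expMap (p : M) (v : TangentSpace (𝓡 d) p) : M :=
  if h : ∃ γ : ℝ → M, IsGeodesic d γ ∧ velocity d γ 0 = (⟨p, v⟩ : TangentBundle (𝓡 d) M)
  then h.choose 1 else p

variable (d M) in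
/-- Every pair of points has a logarithm: a vector `v` at `p` with `exp_p v = q` whose length is the
distance from `p` to `q`. -/
def HasLogarithms : Prop :=
  ∀ p q : M, ∃ v : TangentSpace (𝓡 d) p, expMap p v = q ∧ ‖v‖ = dist p q

end Geometry

section Euclidean

variable {n : ℕ}

/-- The normal cone `N_E(x)`. -/
def normalCone (E : Set (Euc n)) (x : Euc n) : Set (Euc n) :=
  {c | ∀ w ∈ E, inner ℝ c (w - x) ≤ 0}

/-- `x` is the Euclidean projection `Π_E(v)` of `v` to `E`. -/
def IsProjection (E : Set (Euc n)) (v x : Euc n) : Prop :=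
  x ∈ E ∧ ∀ w ∈ E, ‖v - x‖ ≤ ‖v - w‖

end Euclidean

section VI

variable {d n : ℕ} {M : Type*} [MetricSpace M] [ChartedSpace (Euc d) M] [IsManifold (𝓡 d) ∞ M]
  [RiemannianBundle (fun q : M => TangentSpace (𝓡 d) q)] {E : Set (Euc n)}

/-- The operator `F = (F_M, F_T)` on `M × E` is geodesically `μ`-strongly monotone: for all
`z = (γ 0, x)` and `z' = (γ 1, x')`, with `γ` a geodesic and `w` the parallel transport of
`F_M(z')` back along `γ`,
`⟨w - F_M(z), γ'(0)⟩ + ⟨F_T(z') - F_T(z), x' - x⟩ ≥ μ (‖γ'(0)‖² + ‖x' - x‖²)`.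
(The parallel transport `w` always exists and is unique.) -/
def GeodesicallyStronglyMonotone (μ : ℝ) (FM : (p : M) → E → TangentSpace (𝓡 d) p)
    (FT : M → E → Euc n) : Prop :=
  ∀ γ : ℝ → M, IsGeodesic d γ → ∀ x x' : E, ∃ w : TangentSpace (𝓡 d) (γ 0),
    IsParallelTransport γ 1 0 (FM (γ 1) x') w ∧
    μ * (‖(velocity d γ 0).2‖ ^ 2 + ‖(x' : Euc n) - x‖ ^ 2) ≤
      inner ℝ (w - FM (γ 0) x) (velocity d γ 0).2
        + inner ℝ (FT (γ 1) x' - FT (γ 0) x) ((x' : Euc n) - x)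

/-- The operator `F = (F_M, F_T)` on `M × E` is `L`-Lipschitz (along geodesics): with the notation
above, `‖w - F_M(z)‖² + ‖F_T(z') - F_T(z)‖² ≤ L² (‖γ'(0)‖² + ‖x' - x‖²)`. -/
def GeodesicallyLipschitz (L : ℝ) (FM : (p : M) → E → TangentSpace (𝓡 d) p)
    (FT : M → E → Euc n) : Prop :=
  ∀ γ : ℝ → M, IsGeodesic d γ → ∀ x x' : E, ∃ w : TangentSpace (𝓡 d) (γ 0),
    IsParallelTransport γ 1 0 (FM (γ 1) x') w ∧
    ‖w - FM (γ 0) x‖ ^ 2 + ‖FT (γ 1) x' - FT (γ 0) x‖ ^ 2 ≤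
      L ^ 2 * (‖(velocity d γ 0).2‖ ^ 2 + ‖(x' : Euc n) - x‖ ^ 2)

/-- `(p, x)` solves the mixed variational inequality:
`⟨F_M(p, x), γ'(0)⟩ + ⟨F_T(p, x), x' - x⟩ ≥ 0` for every geodesic `γ` issuing from `p` and every
`x' ∈ E`. -/
def IsSolution (FM : (p : M) → E → TangentSpace (𝓡 d) p) (FT : M → E → Euc n)
    (p : M) (x : E) : Prop :=
  ∀ (γ : ℝ → M) (v : TangentSpace (𝓡 d) p), IsGeodesic d γ →
    velocity d γ 0 = (⟨p, v⟩ : TangentBundle (𝓡 d) M) → ∀ x' : E,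
      0 ≤ inner ℝ (FM p x) v + inner ℝ (FT p x) ((x' : Euc n) - x)

/-- The tangent residual `r^tan(p, x) = min_{c ∈ N_E(x)} ‖F_T(p, x) + c‖`. -/
def tangentResidual (FT : M → E → Euc n) (p : M) (x : E) : ℝ :=
  sInf ((fun c => ‖FT p x + c‖) '' normalCone E (x : Euc n))

/-- The step sizes `η₀ = 1 / L` and `η_k = μ / L²` for `k ≥ 1`. -/
def stepSize (μ L : ℝ) (k : ℕ) : ℝ := if k = 0 then 1 / L else μ / L ^ 2

/-- One step of size `η` from `(p, x)` to `(p', x')` with gradient estimate `(gM, gT)`. -/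
def IsDescentStep (η : ℝ) (p : M) (x : E) (gM : TangentSpace (𝓡 d) p) (gT : Euc n)
    (p' : M) (x' : E) : Prop :=
  p' = expMap p (-(η • gM)) ∧ IsProjection E ((x : Euc n) - η • gT) x'

/-- `K` steps of the deterministic algorithm, which uses the exact values of `F`. -/
structure IsDeterministicRun (FM : (p : M) → E → TangentSpace (𝓡 d) p) (FT : M → E → Euc n)
    (η : ℕ → ℝ) (K : ℕ) (p₀ : M) (x₀ : E) (y : ℕ → M) (x : ℕ → E) : Prop where
  init : y 0 = p₀ ∧ x 0 = x₀
  step : ∀ k < K, IsDescentStep (η k) (y k) (x k) (FM (y k) (x k)) (FT (y k) (x k))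
    (y (k + 1)) (x (k + 1))

variable [MeasurableSpace M] {Ξ : Type*} [MeasurableSpace Ξ]

/-- A stochastic oracle: for `ξ` of law `ν`, `(G_M(z, ξ), G_T(z, ξ))` is an unbiased estimator of
`F(z)` of variance at most `σ²`, for every `z ∈ M × E`. -/
structure IsUnbiasedOracle (FM : (p : M) → E → TangentSpace (𝓡 d) p) (FT : M → E → Euc n)
    (ν : Measure Ξ) (GM : (p : M) → E → Ξ → TangentSpace (𝓡 d) p) (GT : M → E → Ξ → Euc n)
    (σ : ℝ) : Prop where
  measurable_FM : Measurable[inferInstance, borel (TangentBundle (𝓡 d) M)]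
    (fun z : M × E => (⟨z.1, FM z.1 z.2⟩ : TangentBundle (𝓡 d) M))
  measurable_FT : Measurable (fun z : M × E => FT z.1 z.2)
  measurable_GM : Measurable[inferInstance, borel (TangentBundle (𝓡 d) M)]
    (fun a : (M × E) × Ξ => (⟨a.1.1, GM a.1.1 a.1.2 a.2⟩ : TangentBundle (𝓡 d) M))
  measurable_GT : Measurable (fun a : (M × E) × Ξ => GT a.1.1 a.1.2 a.2)
  integrable_GM : ∀ p x, Integrable (GM p x) ν
  integrable_GT : ∀ p x, Integrable (GT p x) ν
  unbiased_GM : ∀ p x, ∫ ξ, GM p x ξ ∂ν = FM p x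
  unbiased_GT : ∀ p x, ∫ ξ, GT p x ξ ∂ν = FT p x
  variance_le : ∀ p x,
    ∫⁻ ξ, ENNReal.ofReal (‖GM p x ξ - FM p x‖ ^ 2 + ‖GT p x ξ - FT p x‖ ^ 2) ∂ν
      ≤ ENNReal.ofReal (σ ^ 2)

/-- `K` steps of the stochastic algorithm. In step `k` the oracle is queried at the current iterate
with `m k` samples of law `ν` that are independent of each other and of the past `ℱ k`, and the
average of its answers is used. -/
structure IsStochasticRun {Ω : Type*} {mΩ : MeasurableSpace Ω} (P : Measure Ω) (ν : Measure Ξ)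
    (GM : (p : M) → E → Ξ → TangentSpace (𝓡 d) p) (GT : M → E → Ξ → Euc n)
    (η : ℕ → ℝ) (m : ℕ → ℕ) (K : ℕ) (p₀ : M) (x₀ : E)
    (ℱ : Filtration ℕ mΩ) (S : (k : ℕ) → Fin (m k) → Ω → Ξ)
    (y : ℕ → Ω → M) (x : ℕ → Ω → E) : Prop where
  init : ∀ w, y 0 w = p₀ ∧ x 0 w = x₀
  adapted : ∀ k ≤ K, Measurable[ℱ k] (y k) ∧ Measurable[ℱ k] (x k)
  sample_measurable : ∀ k < K, ∀ i, Measurable (S k i)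
  sample_law : ∀ k < K, ∀ i, P.map (S k i) = ν
  sample_iIndep : ∀ k < K, iIndepFun (S k) P
  sample_indep_past : ∀ k < K,
    Indep (⨆ i, MeasurableSpace.comap (S k i) inferInstance) (ℱ k) P
  step : ∀ k < K, ∀ w, IsDescentStep (η k) (y k w) (x k w)
    ((m k : ℝ)⁻¹ • ∑ i, GM (y k w) (x k w) (S k i w))
    ((m k : ℝ)⁻¹ • ∑ i, GT (y k w) (x k w) (S k i w))
    (y (k + 1) w) (x (k + 1) w)

/-- Lower bounds for the batch sizes: `σ² / (L² B²)` for `k = 0` and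
`12 σ² / (91 μ² κ² B²) * exp (κ² (k - 2) / 4)` for `k ≥ 1`, where `κ = μ / L`. -/
def batchBound (μ L σ B : ℝ) (k : ℕ) : ℝ :=
  if k = 0 then σ ^ 2 / (L ^ 2 * B ^ 2)
  else 12 * σ ^ 2 / (91 * μ ^ 2 * (μ / L) ^ 2 * B ^ 2)
    * Real.exp ((μ / L) ^ 2 / 4 * ((k : ℝ) - 2))

end VI

end

/-! The squared residual r^tan² + ‖F_M‖² itself contracts along the iteration. After the first step
no distance to z* is propagated, so geodesic triangles are never compared and curvature does not
enter. Parallel transport enters only as an isometric and unique map: F_M(z') transported back to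
T_yM is a vector w with ‖w‖ = ‖F_M(z')‖ that satisfies the monotonicity and the Lipschitz inequality
together (`exists_transport`).

Consider a step of size η from z to z' with estimate (g, G), and let u = (x - x')/η. The projection
supplies the vector c = u - G in N_E(x'), so F_T(z') + c = (F_T(z') - F_T(z) + u) - (G - F_T(z)),
and likewise w = (w - F_M(z) + g) - (g - F_M(z)). The displacement is -η(g, u), so monotonicity and
the Lipschitz bound give the error-free parts the factor 1 - 2μη + L²η², which is 1 - κ² at η = μ/L²
(`norm_sq_after_step_le`).

It remains to bound ‖u‖ by r^tan(z). With a the gradient mapping of step size η/2 and ε = G -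
F_T(z), `norm_sq_step_le` gives ‖u‖² ≤ ‖a + ε‖² + ‖ε‖², while ‖a‖ ≤ r^tan(z). As a is independent of
the samples, unbiasedness removes the cross term in expectation.

The first step, of size 1/L, converts distance into residual: F_M(z*) = 0, -F_T(z*) is normal at x*,
and the Lipschitz bound along a logarithm controls F(z_0). In the stochastic case the batch sizes
keep the variance below a multiple κ⁴ of the current bound, which costs half of the exponent. -/

noncomputable section

open Filter Topology

/-! ### Parallel transport is isometric and unique -/

section ParallelTransport

lemma LinearMap.BilinForm.sum_mul_basisFun {d : ℕ} (B : LinearMap.BilinForm ℝ (Euc d))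
    (a b : Euc d) :
    B a b = ∑ i, ∑ j, a i * b j *
      B (EuclideanSpace.basisFun (Fin d) ℝ i) (EuclideanSpace.basisFun (Fin d) ℝ j) := by
  conv_lhs => rw [← (EuclideanSpace.basisFun (Fin d) ℝ).sum_repr a,
    ← (EuclideanSpace.basisFun (Fin d) ℝ).sum_repr b]
  simp [LinearMap.sum_apply, map_sum, Finset.mul_sum, mul_assoc]
  rw [Finset.sum_comm]
  exact Finset.sum_congr rfl fun i _ => Finset.sum_congr rfl fun j _ => by ring

/-- The product rule for a bilinear form that varies with time. -/
lemma hasDerivAt_bilinForm {d : ℕ} {B : ℝ → LinearMap.BilinForm ℝ (Euc d)} {u v : ℝ → Euc d}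
    {u' v' : Euc d} {t D : ℝ} (hB : ∀ a b, DifferentiableAt ℝ (fun s => B s a b) t)
    (hD : HasDerivAt (fun s => B s (u t) (v t)) D t) (hu : HasDerivAt u u' t)
    (hv : HasDerivAt v v' t) :
    HasDerivAt (fun s => B s (u s) (v s)) (B t u' (v t) + B t (u t) v' + D) t := by
  set e := EuclideanSpace.basisFun (Fin d) ℝ
  have hcu : ∀ i, HasDerivAt (fun s => u s i) (u' i) t := fun i =>
    (EuclideanSpace.proj (𝕜 := ℝ) i).hasFDerivAt.comp_hasDerivAt t hu
  have hcv : ∀ i, HasDerivAt (fun s => v s i) (v' i) t := fun i =>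
    (EuclideanSpace.proj (𝕜 := ℝ) i).hasFDerivAt.comp_hasDerivAt t hv
  -- `D` is known only as the derivative at the frozen vectors `u t`, `v t`; uniqueness of
  -- derivatives identifies it with the sum over the entries of the form.
  have h0 : HasDerivAt (fun s => B s (u t) (v t))
      (∑ i, ∑ j, u t i * v t j * deriv (fun s => B s (e i) (e j)) t) t := by
    simp_rw [fun s => (B s).sum_mul_basisFun (u t) (v t)]
    exact HasDerivAt.fun_sum fun i _ => HasDerivAt.fun_sum fun j _ =>
      (hB (e i) (e j)).hasDerivAt.const_mul _
  have h1 : HasDerivAt (fun s => B s (u s) (v s))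
      (∑ i, ∑ j, ((u' i * v t j + u t i * v' j) * B t (e i) (e j)
        + u t i * v t j * deriv (fun s => B s (e i) (e j)) t)) t := by
    simp_rw [fun s => (B s).sum_mul_basisFun (u s) (v s)]
    exact HasDerivAt.fun_sum fun i _ => HasDerivAt.fun_sum fun j _ =>
      ((hcu i).mul (hcv j)).mul (hB (e i) (e j)).hasDerivAt
  refine h1.congr_deriv ?_
  rw [hD.unique h0, (B t).sum_mul_basisFun u', (B t).sum_mul_basisFun (u t)]
  simp_rw [← Finset.sum_add_distrib]
  exact Finset.sum_congr rfl fun i _ => Finset.sum_congr rfl fun j _ => by ring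

variable {d : ℕ} {M : Type*} [MetricSpace M] [ChartedSpace (Euc d) M] [IsManifold (𝓡 d) ∞ M]

lemma mem_baseSet_tangent_iff {p q : M} :
    q ∈ (trivializationAt (Euc d) (fun q : M => TangentSpace (𝓡 d) q) p).baseSet ↔
      q ∈ (extChartAt (𝓡 d) p).source := by
  rw [TangentBundle.trivializationAt_baseSet, extChartAt_source]

lemma hasDerivAt_extChartAt_comp {γ : ℝ → M} (hγ : ContMDiff 𝓘(ℝ, ℝ) (𝓡 d) ∞ γ) (t : ℝ) :
    HasDerivAt (fun s => extChartAt (𝓡 d) (γ t) (γ s)) (tangentCoords (γ t) (velocity d γ t)) t := by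
  have h1 : MDifferentiableAt 𝓘(ℝ, ℝ) (𝓡 d) γ t := hγ.mdifferentiableAt (by simp)
  have h2 : MDifferentiableAt (𝓡 d) 𝓘(ℝ, Euc d) (extChartAt (𝓡 d) (γ t)) (γ t) :=
    mdifferentiableAt_extChartAt (by simp)
  have h3 : DifferentiableAt ℝ (fun s => extChartAt (𝓡 d) (γ t) (γ s)) t :=
    (MDifferentiableAt.comp t h2 h1).differentiableAt
  have h4 : deriv (fun s => extChartAt (𝓡 d) (γ t) (γ s)) t
      = mfderiv (𝓡 d) 𝓘(ℝ, Euc d) (extChartAt (𝓡 d) (γ t)) (γ t)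
          (mfderiv 𝓘(ℝ, ℝ) (𝓡 d) γ t 1) := by
    rw [← fderiv_apply_one_eq_deriv, ← mfderiv_eq_fderiv]
    exact mfderiv_comp_apply t h2 h1 1
  refine h3.hasDerivAt.congr_deriv ?_
  rw [h4, ← TangentBundle.continuousLinearMapAt_trivializationAt (by simp)]
  have := Trivialization.coe_linearMapAt_of_mem (R := ℝ)
    (trivializationAt (Euc d) (fun q : M => TangentSpace (𝓡 d) q) (γ t))
    (FiberBundle.mem_baseSet_trivializationAt' (γ t))
  exact congrFun this (velocity d γ t).2

variable [RiemannianBundle (fun q : M => TangentSpace (𝓡 d) q)]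

/-- The metric at a point of a chart as a bilinear form on component vectors. -/
def chartMetricBilin (p : M) (x : Euc d) : LinearMap.BilinForm ℝ (Euc d) :=
  (innerₗ (TangentSpace (𝓡 d) ((extChartAt (𝓡 d) p).symm x))).compl₁₂
    ((trivializationAt (Euc d) (fun q : M => TangentSpace (𝓡 d) q) p).symmₗ ℝ _)
    ((trivializationAt (Euc d) (fun q : M => TangentSpace (𝓡 d) q) p).symmₗ ℝ _)

lemma chartMetricBilin_apply {p : M} {x : Euc d} (hx : x ∈ (extChartAt (𝓡 d) p).target)
    (a b : Euc d) : chartMetricBilin p x a b = chartMetric p x a b := by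
  have h := mem_baseSet_tangent_iff.2 ((extChartAt (𝓡 d) p).map_target hx)
  simp only [chartMetricBilin, chartMetric, LinearMap.compl₁₂_apply,
    Trivialization.symmₗ_apply _ h]
  rfl

lemma eventually_chartMetricBilin_eq (p : M) :
    ∀ᶠ x in 𝓝 (extChartAt (𝓡 d) p p), ∀ a b,
      chartMetricBilin p x a b = chartMetric p x a b := by
  filter_upwards [extChartAt_target_mem_nhds (I := 𝓡 d) p] with x hx
  exact chartMetricBilin_apply hx

lemma chartMetricDeriv_comm (p : M) (x c a b : Euc d) :
    chartMetricDeriv p x c a b = chartMetricDeriv p x c b a := by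
  unfold chartMetricDeriv chartMetric
  simp_rw [real_inner_comm]

lemma chartMetricBilin_tangentCoords {p q : M} (hq : q ∈ (extChartAt (𝓡 d) p).source)
    (v w : TangentSpace (𝓡 d) q) :
    chartMetricBilin p (extChartAt (𝓡 d) p q) (tangentCoords p ⟨q, v⟩) (tangentCoords p ⟨q, w⟩)
      = inner ℝ v w := by
  rw [chartMetricBilin_apply ((extChartAt (𝓡 d) p).map_source hq)]
  unfold chartMetric
  rw [(extChartAt (𝓡 d) p).left_inv hq]
  unfold tangentCoords
  rw [Trivialization.symm_apply_apply_mk _ (mem_baseSet_tangent_iff.2 hq),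
    Trivialization.symm_apply_apply_mk _ (mem_baseSet_tangent_iff.2 hq)]

lemma chartMetric_comm (p : M) (x a b : Euc d) : chartMetric p x a b = chartMetric p x b a :=
  real_inner_comm _ _

variable [IsContMDiffRiemannianBundle (𝓡 d) ∞ (Euc d) (fun q : M => TangentSpace (𝓡 d) q)]

/-- Fields with constant components in the trivialization are differentiable sections, so their
inner product is differentiable, and so is its composition with the inverse chart. -/
lemma differentiableAt_chartMetric (p : M) (a b : Euc d) :
    DifferentiableAt ℝ (fun x => chartMetric p x a b) (extChartAt (𝓡 d) p p) := by
  have : IsContMDiffRiemannianBundle (𝓡 d) 1 (Euc d) (fun q : M => TangentSpace (𝓡 d) q) :=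
    IsContMDiffRiemannianBundle.of_le (n := ∞) (by norm_cast)
  have hsec : ∀ c : Euc d, MDifferentiableAt (𝓡 d) ((𝓡 d).prod 𝓘(ℝ, Euc d))
      (fun q => TotalSpace.mk' (Euc d) q
        ((trivializationAt (Euc d) (fun q : M => TangentSpace (𝓡 d) q) p).symm q c)) p := by
    intro c
    rw [mdifferentiableAt_section]
    refine (mdifferentiableAt_const (c := c)).congr_of_eventuallyEq ?_
    filter_upwards [(trivializationAt (Euc d) (fun q : M => TangentSpace (𝓡 d) q)
      p).open_baseSet.mem_nhds (FiberBundle.mem_baseSet_trivializationAt' p)] with q hq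
    simp [Trivialization.apply_mk_symm _ hq]
  have h := (hsec a).inner_bundle (hsec b)
  have h2 : MDifferentiableAt 𝓘(ℝ, Euc d) (𝓡 d) (extChartAt (𝓡 d) p).symm
      (extChartAt (𝓡 d) p p) :=
    ((contMDiffOn_extChartAt_symm (n := ∞) p).contMDiffAt
      (extChartAt_target_mem_nhds p)).mdifferentiableAt (by simp)
  -- The inverse chart at the image of `p` equals `p` only propositionally, hence the detour through
  -- a variable `q`.
  have h3 : ∀ q, q = p → MDifferentiableAt (𝓡 d) 𝓘(ℝ, ℝ) (fun q => inner ℝ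
      ((trivializationAt (Euc d) (fun q : M => TangentSpace (𝓡 d) q) p).symm q a)
      ((trivializationAt (Euc d) (fun q : M => TangentSpace (𝓡 d) q) p).symm q b)) q := by
    rintro q rfl
    exact h
  exact (MDifferentiableAt.comp (extChartAt (𝓡 d) p p)
    (h3 _ (extChartAt_to_inv p)) h2).differentiableAt

/-- The Levi-Civita connection is compatible with the metric: the inner product of two parallel
fields is constant. -/
lemma IsParallelAlong.hasDerivAt_inner {γ : ℝ → M} {V W : (t : ℝ) → TangentSpace (𝓡 d) (γ t)}
    (hV : IsParallelAlong γ V) (hW : IsParallelAlong γ W) (t : ℝ) :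
    HasDerivAt (fun s => inner ℝ (V s) (W s)) 0 t := by
  have hφ := hasDerivAt_extChartAt_comp hV.smooth t
  have hev := (hφ.continuousAt.tendsto.eventually (eventually_chartMetricBilin_eq (γ t)))
  have hcomp : ∀ a b, HasDerivAt
      (fun s => chartMetricBilin (γ t) (extChartAt (𝓡 d) (γ t) (γ s)) a b)
      (chartMetricDeriv (γ t) (extChartAt (𝓡 d) (γ t) (γ t))
        (tangentCoords (γ t) (velocity d γ t)) a b) t := by
    intro a b
    refine HasDerivAt.congr_of_eventuallyEq ?_ (hev.mono fun s hs => hs a b)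
    exact (differentiableAt_chartMetric (γ t) a b).hasFDerivAt.comp_hasDerivAt t hφ
  have key := hasDerivAt_bilinForm (fun a b => (hcomp a b).differentiableAt)
    (hcomp _ _) (hV.differentiable t).hasDerivAt (hW.differentiable t).hasDerivAt
  have hsrc : ∀ᶠ s in 𝓝 t, γ s ∈ (extChartAt (𝓡 d) (γ t)).source :=
    hV.smooth.continuous.continuousAt.eventually (extChartAt_source_mem_nhds (I := 𝓡 d) (γ t))
  have heq : (fun s => inner ℝ (V s) (W s)) =ᶠ[𝓝 t] _ :=
    hsrc.mono fun s hs => (chartMetricBilin_tangentCoords hs (V s) (W s)).symm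
  refine HasDerivAt.congr_of_eventuallyEq ?_ heq
  refine key.congr_deriv ?_
  -- Pairing each parallel equation with the other field, the two Christoffel terms add up to the
  -- derivative of g(V, W) along γ' at fixed components; their remaining parts cancel by symmetry of
  -- the metric.
  have h1 := hV.equation t (tangentCoords (γ t) ⟨γ t, W t⟩)
  have h2 := hW.equation t (tangentCoords (γ t) ⟨γ t, V t⟩)
  rw [chartMetric_comm] at h2
  rw [chartMetricBilin_apply (mem_extChartAt_target (γ t)),
    chartMetricBilin_apply (mem_extChartAt_target (γ t))]
  unfold christoffelFirst at h1 h2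
  rw [chartMetricDeriv_comm _ _ _ (tangentCoords (γ t) ⟨γ t, W t⟩)
    (tangentCoords (γ t) ⟨γ t, V t⟩)] at h2
  linarith

lemma IsParallelAlong.inner_eq {γ : ℝ → M} {V W : (t : ℝ) → TangentSpace (𝓡 d) (γ t)}
    (hV : IsParallelAlong γ V) (hW : IsParallelAlong γ W) (s t : ℝ) :
    (inner ℝ (V s) (W s) : ℝ) = inner ℝ (V t) (W t) :=
  is_const_of_deriv_eq_zero (fun r => (hV.hasDerivAt_inner hW r).differentiableAt)
    (fun r => (hV.hasDerivAt_inner hW r).deriv) s t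

/-- Parallel transport is isometric. -/
lemma IsParallelTransport.norm_eq {γ : ℝ → M} {s t : ℝ} {v : TangentSpace (𝓡 d) (γ s)}
    {w : TangentSpace (𝓡 d) (γ t)} (h : IsParallelTransport γ s t v w) : ‖w‖ = ‖v‖ := by
  obtain ⟨V, hV, rfl, rfl⟩ := h
  rw [← sq_eq_sq₀ (norm_nonneg _) (norm_nonneg _), ← real_inner_self_eq_norm_sq,
    ← real_inner_self_eq_norm_sq]
  exact hV.inner_eq hV t s

/-- Parallel transport is unique. -/
lemma IsParallelTransport.unique {γ : ℝ → M} {s t : ℝ} {v : TangentSpace (𝓡 d) (γ s)}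
    {w w' : TangentSpace (𝓡 d) (γ t)} (h : IsParallelTransport γ s t v w)
    (h' : IsParallelTransport γ s t v w') : w = w' := by
  obtain ⟨V, hV, hs, rfl⟩ := h
  obtain ⟨W, hW, hs', rfl⟩ := h'
  -- ‖w - w'‖² expands into inner products of parallel fields. These are constant and cancel at time
  -- `s`, where the fields agree.
  rw [← sub_eq_zero, ← inner_self_eq_zero (𝕜 := ℝ), inner_sub_left, inner_sub_right,
    inner_sub_right, hV.inner_eq hV t s, hV.inner_eq hW t s, hW.inner_eq hV t s,
    hW.inner_eq hW t s, hs, hs']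
  simp

end ParallelTransport

/-! ### Both hypotheses on F along an exponential step -/

section Exponential

variable {d n : ℕ} {M : Type*} [MetricSpace M] [ChartedSpace (Euc d) M] [IsManifold (𝓡 d) ∞ M]
  [RiemannianBundle (fun q : M => TangentSpace (𝓡 d) q)]

lemma exists_isGeodesic_expMap (hexp : GeodesicallyComplete d M) (p : M)
    (v : TangentSpace (𝓡 d) p) :
    ∃ γ : ℝ → M, IsGeodesic d γ ∧ velocity d γ 0 = (⟨p, v⟩ : TangentBundle (𝓡 d) M) ∧
      γ 1 = expMap p v := by
  have h : ∃ γ : ℝ → M, IsGeodesic d γ ∧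
      velocity d γ 0 = (⟨p, v⟩ : TangentBundle (𝓡 d) M) := hexp ⟨p, v⟩
  refine ⟨h.choose, h.choose_spec.1, h.choose_spec.2, ?_⟩
  unfold expMap
  rw [dif_pos h]

variable [IsContMDiffRiemannianBundle (𝓡 d) ∞ (Euc d) (fun q : M => TangentSpace (𝓡 d) q)]
  {E : Set (Euc n)} {FM : (p : M) → E → TangentSpace (𝓡 d) p} {FT : M → E → Euc n} {μ L : ℝ}

/-- The monotonicity and Lipschitz inequalities between `(p, x)` and `(exp_p v, x')`, where `w` is
the value of `F_M` at the second point, transported back to `p`. -/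
lemma exists_transport (hexp : GeodesicallyComplete d M)
    (hmono : GeodesicallyStronglyMonotone μ FM FT) (hlip : GeodesicallyLipschitz L FM FT)
    (p : M) (v : TangentSpace (𝓡 d) p) (x x' : E) :
    ∃ w : TangentSpace (𝓡 d) p, ‖w‖ = ‖FM (expMap p v) x'‖ ∧
      μ * (‖v‖ ^ 2 + ‖(x' : Euc n) - x‖ ^ 2) ≤
        inner ℝ (w - FM p x) v + inner ℝ (FT (expMap p v) x' - FT p x) ((x' : Euc n) - x) ∧
      ‖w - FM p x‖ ^ 2 + ‖FT (expMap p v) x' - FT p x‖ ^ 2 ≤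
        L ^ 2 * (‖v‖ ^ 2 + ‖(x' : Euc n) - x‖ ^ 2) := by
  obtain ⟨γ, hγ, hv, h1⟩ := exists_isGeodesic_expMap hexp p v
  rw [← h1]
  clear h1
  have hp : γ 0 = p := congrArg TotalSpace.proj hv
  subst hp
  have hv' : (velocity d γ 0).2 = v := eq_of_heq (TotalSpace.mk.inj hv).2
  subst hv'
  obtain ⟨w, hw, hm⟩ := hmono γ hγ x x'
  obtain ⟨w', hw', hl⟩ := hlip γ hγ x x'
  -- Each hypothesis brings its own transported vector; uniqueness merges them.
  obtain rfl := hw.unique hw'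
  exact ⟨w, hw.norm_eq, hm, hl⟩

end Exponential

/-! ### Normal cones, projections and gradient mappings -/

section Projection

variable {n : ℕ} {E : Set (Euc n)}

lemma IsProjection.sub_mem_normalCone (hE : Convex ℝ E) {v x : Euc n} (h : IsProjection E v x) :
    v - x ∈ normalCone E x := by
  have : Nonempty E := ⟨⟨x, h.1⟩⟩
  refine (norm_eq_iInf_iff_real_inner_le_zero hE h.1).1 (le_antisymm ?_ ?_)
  · exact le_ciInf fun w => h.2 w w.2
  · exact ciInf_le ⟨0, by rintro _ ⟨w, rfl⟩; exact norm_nonneg _⟩ (⟨x, h.1⟩ : E)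

lemma smul_mem_normalCone {x c : Euc n} (hc : c ∈ normalCone E x) {a : ℝ} (ha : 0 ≤ a) :
    a • c ∈ normalCone E x := fun w hw => by
  rw [real_inner_smul_left]
  exact mul_nonpos_of_nonneg_of_nonpos ha (hc w hw)

/-- Monotonicity of the normal cone operator. Nonexpansiveness, the bound for the gradient mapping
and the estimate for a noisy step all come from it. -/
lemma inner_sub_nonneg_of_mem_normalCone {x y c c' : Euc n} (hx : x ∈ E) (hy : y ∈ E)
    (hc : c ∈ normalCone E x) (hc' : c' ∈ normalCone E y) :
    0 ≤ inner ℝ (c - c') (x - y) := by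
  have h1 := hc y hy
  have h2 := hc' x hx
  rw [← neg_sub x y, inner_neg_right] at h1
  rw [inner_sub_left]
  linarith

/-- Projections to a convex set are nonexpansive. -/
lemma IsProjection.norm_sub_le (hE : Convex ℝ E) {v w x y : Euc n} (hx : IsProjection E v x)
    (hy : IsProjection E w y) : ‖x - y‖ ≤ ‖v - w‖ := by
  have h := inner_sub_nonneg_of_mem_normalCone hx.1 hy.1 (hx.sub_mem_normalCone hE)
    (hy.sub_mem_normalCone hE)
  have h1 : inner ℝ (v - x - (w - y)) (x - y) = inner ℝ (v - w) (x - y) - ‖x - y‖ ^ 2 := by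
    rw [← real_inner_self_eq_norm_sq, ← inner_sub_left]
    congr 1
    abel
  have h2 := real_inner_le_norm (v - w) (x - y)
  rcases (norm_nonneg (x - y)).eq_or_lt with h0 | h0
  · rw [← h0]
    exact norm_nonneg _
  · nlinarith

lemma exists_isProjection (hE : Convex ℝ E) (hc : IsClosed E) (hne : E.Nonempty) (v : Euc n) :
    ∃ x, IsProjection E v x := by
  obtain ⟨x, hx, h⟩ := exists_norm_eq_iInf_of_complete_convex hne hc.isComplete hE v
  refine ⟨x, hx, fun w hw => ?_⟩
  rw [h]
  exact ciInf_le ⟨0, by rintro _ ⟨w, rfl⟩; exact norm_nonneg _⟩ (⟨w, hw⟩ : E)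

open scoped Classical in
/-- The projection to `E` as a function (the identity where there is none). -/
def projection (E : Set (Euc n)) (v : Euc n) : Euc n :=
  if h : ∃ x, IsProjection E v x then h.choose else v

lemma isProjection_projection (hE : Convex ℝ E) (hc : IsClosed E) (hne : E.Nonempty)
    (v : Euc n) : IsProjection E v (projection E v) := by
  have h := exists_isProjection hE hc hne v
  rw [projection, dif_pos h]
  exact h.choose_spec

lemma continuous_projection (hE : Convex ℝ E) (hc : IsClosed E) (hne : E.Nonempty) :
    Continuous (projection E) := by
  refine (LipschitzWith.of_dist_le_mul (K := 1) fun v w => ?_).continuous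
  rw [dist_eq_norm, dist_eq_norm, NNReal.coe_one, one_mul]
  exact (isProjection_projection hE hc hne v).norm_sub_le hE (isProjection_projection hE hc hne w)

/-- The gradient mapping `(x - Π_E(x - h F)) / h`. -/
def gradientMapping (E : Set (Euc n)) (h : ℝ) (x F : Euc n) : Euc n :=
  h⁻¹ • (x - projection E (x - h • F))

/-- Monotonicity of the normal cone between `x` and its projected step gives ⟨F + c - a, a⟩ ≥ 0 for
the gradient mapping a, and Cauchy–Schwarz concludes. The step size is arbitrary, which later
permits η/2. -/
lemma norm_gradientMapping_le (hE : Convex ℝ E) (hcl : IsClosed E) {h : ℝ} (hh : 0 < h)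
    {x F c : Euc n} (hx : x ∈ E) (hc : c ∈ normalCone E x) :
    ‖gradientMapping E h x F‖ ≤ ‖F + c‖ := by
  have hp := isProjection_projection hE hcl ⟨x, hx⟩ (x - h • F)
  set p := projection E (x - h • F)
  have hgm : gradientMapping E h x F = h⁻¹ • (x - p) := rfl
  set a := gradientMapping E h x F
  have hxp : x - p = h • a := by rw [hgm, smul_smul, mul_inv_cancel₀ hh.ne', one_smul]
  have h1 := inner_sub_nonneg_of_mem_normalCone hx hp.1 (smul_mem_normalCone hc hh.le)
    (hp.sub_mem_normalCone hE)
  have h2 : h • c - (x - h • F - p) = h • (F + c - a) := by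
    rw [smul_sub, ← hxp, smul_add]
    abel
  rw [h2, hxp, real_inner_smul_left, real_inner_smul_right, inner_sub_left,
    real_inner_self_eq_norm_sq] at h1
  have h3 := real_inner_le_norm (F + c) a
  have h4 : 0 ≤ inner ℝ (F + c) a - ‖a‖ ^ 2 := by
    by_contra hneg
    push Not at hneg
    nlinarith [mul_pos hh hh]
  rcases (norm_nonneg a).eq_or_lt with h0 | h0
  · rw [← h0]
    exact norm_nonneg _
  · nlinarith

/-- A projected step of size `η` along `G` compared with the gradient mapping of `F` at step size
`η / 2`. -/
lemma norm_sq_step_le (hE : Convex ℝ E) (hcl : IsClosed E) {η : ℝ} (hη : 0 < η)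
    {x x' F G : Euc n} (hx' : IsProjection E (x - η • G) x') :
    ‖η⁻¹ • (x - x')‖ ^ 2 ≤
      ‖gradientMapping E (η / 2) x F + (G - F)‖ ^ 2 + ‖G - F‖ ^ 2 := by
  have hp := isProjection_projection hE hcl ⟨x', hx'.1⟩ (x - (η / 2) • F)
  set p := projection E (x - (η / 2) • F)
  have hgm : gradientMapping E (η / 2) x F = (η / 2)⁻¹ • (x - p) := rfl
  set a := gradientMapping E (η / 2) x F
  set u := η⁻¹ • (x - x') with hu
  set ε := G - F
  have hxp : x - p = (η / 2) • a := by
    rw [hgm, smul_smul, mul_inv_cancel₀ (half_pos hη).ne', one_smul]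
  have hxu : x - x' = η • u := by rw [hu, smul_smul, mul_inv_cancel₀ hη.ne', one_smul]
  -- The normal vector of the half step is doubled so that both carry the gradient with the same
  -- factor η; `F` and `G` then enter only through `ε`.
  have h1 := inner_sub_nonneg_of_mem_normalCone hx'.1 hp.1 (hx'.sub_mem_normalCone hE)
    (smul_mem_normalCone (hp.sub_mem_normalCone hE) zero_le_two)
  have h2 : x - η • G - x' - (2 : ℝ) • (x - (η / 2) • F - p) = η • (u - ε - a) := by
    have e1 : x - η • G - x' = η • u - η • G := by rw [← hxu]; abel
    have e2 : x - (η / 2) • F - p = (η / 2) • a - (η / 2) • F := by rw [← hxp]; abel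
    rw [e1, e2]
    module
  have h3 : x' - p = (η / 2) • (a - (2 : ℝ) • u) := by
    have : x' - p = (η / 2) • a - η • u := by rw [← hxu, ← hxp]; abel
    rw [this]
    module
  rw [h2, h3, real_inner_smul_left, real_inner_smul_right] at h1
  have h4 : 0 ≤ inner ℝ (u - ε - a) (a - (2 : ℝ) • u) := by
    by_contra hneg
    push Not at hneg
    nlinarith [mul_pos hη (half_pos hη)]
  -- The gap is the pairing of `h4` plus squares. In the resulting bound `ε` sits linearly next to
  -- `a`, which does not involve `G`, so the cross term has mean zero for an unbiased `G`.
  have h5 : ‖a + ε‖ ^ 2 + ‖ε‖ ^ 2 - ‖u‖ ^ 2 =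
      2 * inner ℝ (u - ε - a) (a - (2 : ℝ) • u) + ‖u - a‖ ^ 2 + 2 * ‖u - a - ε‖ ^ 2 := by
    simp only [← real_inner_self_eq_norm_sq, inner_sub_left, inner_sub_right, inner_add_left,
      inner_add_right, real_inner_smul_right, real_inner_comm u a, real_inner_comm ε a,
      real_inner_comm u ε]
    ring
  nlinarith [sq_nonneg ‖u - a‖, sq_nonneg ‖u - a - ε‖]

end Projection

/-! ### The tangent residual -/

section Residual

variable {n : ℕ} {M : Type*} {E : Set (Euc n)} {FT : M → E → Euc n} {p : M} {x : E}

lemma tangentResidual_nonneg : 0 ≤ tangentResidual FT p x :=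
  Real.sInf_nonneg (by rintro _ ⟨c, -, rfl⟩; exact norm_nonneg _)

lemma tangentResidual_le {c : Euc n} (hc : c ∈ normalCone E (x : Euc n)) :
    tangentResidual FT p x ≤ ‖FT p x + c‖ :=
  csInf_le ⟨0, by rintro _ ⟨c, -, rfl⟩; exact norm_nonneg _⟩ ⟨c, hc, rfl⟩

lemma norm_gradientMapping_le_tangentResidual (hE : Convex ℝ E) (hcl : IsClosed E) {h : ℝ}
    (hh : 0 < h) : ‖gradientMapping E h x (FT p x)‖ ≤ tangentResidual FT p x := by
  refine le_csInf ⟨_, 0, fun w _ => by simp, rfl⟩ ?_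
  rintro _ ⟨c, hc, rfl⟩
  exact norm_gradientMapping_le hE hcl hh x.2 hc

end Residual

/-! ### Operator norm after one step -/

section OneStep

lemma norm_sub_sq_le_young {H : Type*} [NormedAddCommGroup H] (a b : H) {t : ℝ} (ht : 0 < t) :
    ‖a - b‖ ^ 2 ≤ (1 + t) * ‖a‖ ^ 2 + (1 + 1 / t) * ‖b‖ ^ 2 := by
  have h1 : ‖a - b‖ ^ 2 ≤ (‖a‖ + ‖b‖) ^ 2 := by gcongr; exact norm_sub_le a b
  have h2 : (1 + t) * ‖a‖ ^ 2 + (1 + 1 / t) * ‖b‖ ^ 2 - (‖a‖ + ‖b‖) ^ 2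
      = (t * ‖a‖ - ‖b‖) ^ 2 / t := by
    field_simp
    ring
  have h3 : 0 ≤ (t * ‖a‖ - ‖b‖) ^ 2 / t := by positivity
  linarith

variable {H T : Type*} [NormedAddCommGroup H] [InnerProductSpace ℝ H]
  [NormedAddCommGroup T] [InnerProductSpace ℝ T]

/-- When `x'` is the projected step, the left side is a competitor in the tangent residual at `x'`.
The right side separates the error-free part from the estimation error. -/
lemma normal_vector_decomposition {η : ℝ} (hη : η ≠ 0) (x x' F F' G : T) :
    F' + η⁻¹ • (x - η • G - x') = (F' - F + η⁻¹ • (x - x')) - (G - F) := by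
  have : η⁻¹ • (x - η • G - x') = η⁻¹ • (x - x') - G := by
    rw [show x - η • G - x' = (x - x') - η • G by abel, smul_sub, smul_smul, inv_mul_cancel₀ hη,
      one_smul]
  rw [this]
  abel

/-- The operator norm after a step of size `μ / L²`: `w` stands for the transported value of the
manifold component, and `η⁻¹ • (x - η • G - x')` for the normal vector found by the projection. -/
lemma norm_sq_after_step_le {μ L η t : ℝ} (hμ : 0 < μ) (hL : 0 < L) (hη : η = μ / L ^ 2)
    (ht : 0 < t) {f g w : H} {x x' F F' G : T}
    (hm : μ * (‖-(η • g)‖ ^ 2 + ‖x' - x‖ ^ 2) ≤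
      inner ℝ (w - f) (-(η • g)) + inner ℝ (F' - F) (x' - x))
    (hl : ‖w - f‖ ^ 2 + ‖F' - F‖ ^ 2 ≤ L ^ 2 * (‖-(η • g)‖ ^ 2 + ‖x' - x‖ ^ 2)) :
    ‖w‖ ^ 2 + ‖F' + η⁻¹ • (x - η • G - x')‖ ^ 2 ≤
      (1 + t) * (1 - (μ / L) ^ 2) * (‖g‖ ^ 2 + ‖η⁻¹ • (x - x')‖ ^ 2)
        + (1 + 1 / t) * (‖g - f‖ ^ 2 + ‖G - F‖ ^ 2) := by
  have hη0 : 0 < η := by rw [hη]; positivity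
  rw [normal_vector_decomposition hη0.ne' x x' F F' G]
  set u := η⁻¹ • (x - x') with hu
  have hxu : x' - x = -(η • u) := by
    rw [hu, smul_smul, mul_inv_cancel₀ hη0.ne', one_smul, neg_sub]
  have hw : w = (w - f + g) - (g - f) := by abel
  set a := w - f
  set b := F' - F
  rw [hxu] at hm hl
  simp only [norm_neg, inner_neg_right, real_inner_smul_right, norm_smul, mul_pow,
    Real.norm_eq_abs, sq_abs] at hm hl
  have hP : inner ℝ a g + inner ℝ b u ≤ -(μ * η) * (‖g‖ ^ 2 + ‖u‖ ^ 2) := by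
    have : η * (inner ℝ a g + inner ℝ b u) ≤ η * (-(μ * η) * (‖g‖ ^ 2 + ‖u‖ ^ 2)) := by
      nlinarith
    exact le_of_mul_le_mul_left this hη0
  -- The factor is 1 - 2μη + L²η², minimal at η = μ/L².
  have hsum : ‖a + g‖ ^ 2 + ‖b + u‖ ^ 2 ≤ (1 - (μ / L) ^ 2) * (‖g‖ ^ 2 + ‖u‖ ^ 2) := by
    rw [norm_add_sq_real, norm_add_sq_real]
    have e1 : L ^ 2 * η ^ 2 = (μ / L) ^ 2 := by rw [hη]; field_simp
    have e2 : μ * η = (μ / L) ^ 2 := by rw [hη]; field_simp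
    rw [e2] at hP
    have : L ^ 2 * (η ^ 2 * ‖g‖ ^ 2 + η ^ 2 * ‖u‖ ^ 2)
        = (μ / L) ^ 2 * (‖g‖ ^ 2 + ‖u‖ ^ 2) := by rw [← e1]; ring
    rw [this] at hl
    linarith
  have y1 := norm_sub_sq_le_young (a + g) (g - f) ht
  rw [← hw] at y1
  have y2 := norm_sub_sq_le_young (b + u) (G - F) ht
  have := mul_le_mul_of_nonneg_left hsum (by linarith : 0 ≤ 1 + t)
  linarith

/-- The operator norm after a step of size `1 / L`, in terms of the length of the step. -/
lemma norm_sq_after_first_step_le {L η : ℝ} (hL : 0 < L) (hη : η = 1 / L)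
    {f g w : H} {x x' F F' G : T}
    (hl : ‖w - f‖ ^ 2 + ‖F' - F‖ ^ 2 ≤ L ^ 2 * (‖-(η • g)‖ ^ 2 + ‖x' - x‖ ^ 2)) :
    ‖w‖ ^ 2 + ‖F' + η⁻¹ • (x - η • G - x')‖ ^ 2 ≤
      9 / 2 * (‖g‖ ^ 2 + ‖η⁻¹ • (x - x')‖ ^ 2) + 9 * (‖g - f‖ ^ 2 + ‖G - F‖ ^ 2) := by
  have hη0 : 0 < η := by rw [hη]; positivity
  rw [normal_vector_decomposition hη0.ne' x x' F F' G]
  set u := η⁻¹ • (x - x') with hu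
  have hxu : x' - x = -(η • u) := by
    rw [hu, smul_smul, mul_inv_cancel₀ hη0.ne', one_smul, neg_sub]
  have hw : w = (w - f + g) - (g - f) := by abel
  set a := w - f
  set b := F' - F
  rw [hxu] at hl
  simp only [norm_neg, norm_smul, mul_pow, Real.norm_eq_abs, sq_abs] at hl
  have e1 : L ^ 2 * η ^ 2 = 1 := by rw [hη]; field_simp
  have e2 : L ^ 2 * (η ^ 2 * ‖g‖ ^ 2 + η ^ 2 * ‖u‖ ^ 2) = ‖g‖ ^ 2 + ‖u‖ ^ 2 := by
    linear_combination (‖g‖ ^ 2 + ‖u‖ ^ 2) * e1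
  rw [e2] at hl
  -- By the parallelogram law and Lη = 1 the error-free part is at most 4(‖g‖² + ‖u‖²). With t = 1/8
  -- the constants become 9/8 · 4 = 9/2 and 1 + 8 = 9.
  have y1 := norm_sub_sq_le_young (a + g) (g - f) (t := 1 / 8) (by norm_num)
  rw [← hw] at y1
  have y2 := norm_sub_sq_le_young (b + u) (G - F) (t := 1 / 8) (by norm_num)
  have p1 := parallelogram_law_with_norm ℝ a g
  have p2 := parallelogram_law_with_norm ℝ b u
  nlinarith [mul_self_nonneg ‖a - g‖, mul_self_nonneg ‖b - u‖]

end OneStep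

/-! ### Bias and variance of batch averages -/

section Batch

/-- Only the sum of the squared errors is assumed to have a finite integral; each summand is
measurable and dominated by it. -/
lemma integrable_norm_sq_of_variance_le {Ξ H T : Type*} [MeasurableSpace Ξ] {ν : Measure Ξ}
    [NormedAddCommGroup H] [NormedAddCommGroup T] {f : Ξ → H} {F : H}
    {g : Ξ → T} {G : T} {σ : ℝ} (hf : Integrable f ν) (hg : Integrable g ν)
    (hv : ∫⁻ ξ, ENNReal.ofReal (‖f ξ - F‖ ^ 2 + ‖g ξ - G‖ ^ 2) ∂ν ≤ ENNReal.ofReal (σ ^ 2)) :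
    Integrable (fun ξ => ‖f ξ - F‖ ^ 2) ν ∧ Integrable (fun ξ => ‖g ξ - G‖ ^ 2) ν ∧
      (∫ ξ, ‖f ξ - F‖ ^ 2 ∂ν) + ∫ ξ, ‖g ξ - G‖ ^ 2 ∂ν ≤ σ ^ 2 := by
  have hfm : AEStronglyMeasurable (fun ξ => ‖f ξ - F‖ ^ 2) ν :=
    (hf.1.sub aestronglyMeasurable_const).norm.pow 2
  have hgm : AEStronglyMeasurable (fun ξ => ‖g ξ - G‖ ^ 2) ν :=
    (hg.1.sub aestronglyMeasurable_const).norm.pow 2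
  have hsum : Integrable (fun ξ => ‖f ξ - F‖ ^ 2 + ‖g ξ - G‖ ^ 2) ν := by
    refine ⟨hfm.add hgm, ?_⟩
    rw [hasFiniteIntegral_iff_ofReal (ae_of_all _ fun ξ => by positivity)]
    exact hv.trans_lt ENNReal.ofReal_lt_top
  have h1 : Integrable (fun ξ => ‖f ξ - F‖ ^ 2) ν :=
    hsum.mono' hfm (ae_of_all _ fun ξ => by simp)
  have h2 : Integrable (fun ξ => ‖g ξ - G‖ ^ 2) ν :=
    hsum.mono' hgm (ae_of_all _ fun ξ => by simp)
  refine ⟨h1, h2, ?_⟩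
  rw [← integral_add h1 h2]
  rw [← ofReal_integral_eq_lintegral_ofReal hsum (ae_of_all _ fun ξ => by positivity)] at hv
  exact (ENNReal.ofReal_le_ofReal_iff (sq_nonneg σ)).1 hv

variable {Ξ H : Type*} [NormedAddCommGroup H] [InnerProductSpace ℝ H]

/-- The error of the average of `m` samples of `f` as an estimator of `F`. -/
def batchError {m : ℕ} (f : Ξ → H) (F : H) (s : Fin m → Ξ) : H :=
  (m : ℝ)⁻¹ • ∑ i, f (s i) - F

lemma batchError_eq {m : ℕ} (hm : 0 < m) (f : Ξ → H) (F : H) (s : Fin m → Ξ) :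
    batchError f F s = (m : ℝ)⁻¹ • ∑ i, (f (s i) - F) := by
  have : (m : ℝ) ≠ 0 := by positivity
  rw [batchError, Finset.sum_sub_distrib, smul_sub]
  simp [← Nat.cast_smul_eq_nsmul ℝ, smul_smul, this]

lemma norm_sq_batchError {m : ℕ} (hm : 0 < m) (f : Ξ → H) (F : H) (s : Fin m → Ξ) :
    ‖batchError f F s‖ ^ 2
      = ((m : ℝ)⁻¹) ^ 2 * ∑ i, ∑ j, inner ℝ (f (s i) - F) (f (s j) - F) := by
  rw [batchError_eq hm, norm_smul, mul_pow, Real.norm_eq_abs, sq_abs,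
    ← real_inner_self_eq_norm_sq, sum_inner]
  simp_rw [inner_sum]

variable [MeasurableSpace Ξ] {ν : Measure Ξ} [IsProbabilityMeasure ν] {f : Ξ → H} {F : H}

lemma integrable_sample {G : Type*} [NormedAddCommGroup G] {f : Ξ → G} {F : G}
    (hf : Integrable f ν) {m : ℕ} (i : Fin m) :
    Integrable (fun s : Fin m → Ξ => f (s i) - F) (Measure.pi fun _ => ν) :=
  (measurePreserving_eval (fun _ : Fin m => ν) i).integrable_comp_of_integrable
    (g := fun ξ => f ξ - F) (hf.sub (integrable_const F))

lemma integral_comp_sample {G : Type*} [NormedAddCommGroup G] [NormedSpace ℝ G] {g : Ξ → G}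
    (hg : AEStronglyMeasurable g ν) {m : ℕ} (i : Fin m) :
    ∫ s, g (s i) ∂(Measure.pi fun _ : Fin m => ν) = ∫ ξ, g ξ ∂ν := by
  have hp := measurePreserving_eval (fun _ : Fin m => ν) i
  have := integral_map (f := g) hp.aemeasurable (by rwa [hp.map_eq])
  rw [hp.map_eq] at this
  exact this.symm

lemma integrable_inner_sample (hf : Integrable f ν)
    (hf2 : Integrable (fun ξ => ‖f ξ - F‖ ^ 2) ν) {m : ℕ} (i j : Fin m) :
    Integrable (fun s : Fin m → Ξ => inner ℝ (f (s i) - F) (f (s j) - F))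
      (Measure.pi fun _ => ν) := by
  have hp := fun k : Fin m => measurePreserving_eval (fun _ : Fin m => ν) k
  have hi : ∀ k, AEStronglyMeasurable (fun s : Fin m → Ξ => f (s k) - F)
      (Measure.pi fun _ => ν) := fun k =>
    (hf.1.sub aestronglyMeasurable_const).comp_measurePreserving (hp k)
  have hn : ∀ k, Integrable (fun s : Fin m → Ξ => ‖f (s k) - F‖ ^ 2) (Measure.pi fun _ => ν) :=
    fun k => (hp k).integrable_comp_of_integrable hf2
  refine ((hn i).add (hn j)).mono' ((hi i).inner (hi j)) (ae_of_all _ fun s => ?_)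
  simp only [Pi.add_apply]
  have := norm_inner_le_norm (𝕜 := ℝ) (f (s i) - F) (f (s j) - F)
  nlinarith [sq_nonneg (‖f (s i) - F‖ - ‖f (s j) - F‖), sq_nonneg ‖f (s i) - F‖,
    sq_nonneg ‖f (s j) - F‖]

lemma integrable_batchError (hf : Integrable f ν) {m : ℕ} (hm : 0 < m) :
    Integrable (fun s : Fin m → Ξ => batchError f F s) (Measure.pi fun _ => ν) := by
  simp_rw [batchError_eq hm]
  exact (integrable_finsetSum _ fun i _ => integrable_sample hf i).smul _

lemma integrable_norm_sq_batchError (hf : Integrable f ν)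
    (hf2 : Integrable (fun ξ => ‖f ξ - F‖ ^ 2) ν) {m : ℕ} (hm : 0 < m) :
    Integrable (fun s : Fin m → Ξ => ‖batchError f F s‖ ^ 2) (Measure.pi fun _ => ν) := by
  simp_rw [norm_sq_batchError hm]
  exact (integrable_finsetSum _ fun i _ => integrable_finsetSum _ fun j _ =>
    integrable_inner_sample hf hf2 i j).const_mul _

lemma integrable_norm_sq_add_batchError (hf : Integrable f ν)
    (hf2 : Integrable (fun ξ => ‖f ξ - F‖ ^ 2) ν) {m : ℕ} (hm : 0 < m) (c : H) :
    Integrable (fun s : Fin m → Ξ => ‖c + batchError f F s‖ ^ 2) (Measure.pi fun _ => ν) := by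
  simp_rw [norm_add_sq_real]
  exact ((integrable_const _).add
    (((integrable_batchError hf hm).const_inner c).const_mul 2)).add
      (integrable_norm_sq_batchError hf hf2 hm)

variable [CompleteSpace H]

lemma integral_sample_sub (hf : Integrable f ν) (hF : ∫ ξ, f ξ ∂ν = F) {m : ℕ} (i : Fin m) :
    ∫ s, (f (s i) - F) ∂(Measure.pi fun _ : Fin m => ν) = 0 := by
  rw [integral_comp_sample (g := fun ξ => f ξ - F) (hf.1.sub aestronglyMeasurable_const),
    integral_sub hf (integrable_const F), hF]
  simp

lemma integral_inner_sample (hf : Integrable f ν) (hF : ∫ ξ, f ξ ∂ν = F) {m : ℕ} (i j : Fin m) :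
    ∫ s, inner ℝ (f (s i) - F) (f (s j) - F) ∂(Measure.pi fun _ : Fin m => ν)
      = if i = j then ∫ ξ, ‖f ξ - F‖ ^ 2 ∂ν else 0 := by
  have hp := fun k : Fin m => measurePreserving_eval (fun _ : Fin m => ν) k
  have hfF : Integrable (fun ξ => f ξ - F) ν := hf.sub (integrable_const F)
  split_ifs with h
  · subst h
    simp_rw [real_inner_self_eq_norm_sq]
    exact integral_comp_sample (g := fun ξ => ‖f ξ - F‖ ^ 2) (hfF.1.norm.pow 2) i
  -- Distinct coordinates are independent, so the expectation factors into the inner product of two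
  -- vanishing means.
  · have hind : IndepFun (fun s : Fin m → Ξ => s i) (fun s => s j) (Measure.pi fun _ => ν) :=
      (iIndepFun_pi (μ := fun _ : Fin m => ν) (X := fun _ => id)
        (fun _ => aemeasurable_id)).indepFun h
    have h1 := hind.integral_bilin_comp_comp (f := fun ξ => f ξ - F) (g := fun ξ => f ξ - F)
      (hp i).aemeasurable (hp j).aemeasurable (by rwa [(hp i).map_eq])
      (by rwa [(hp j).map_eq]) (innerSL ℝ)
    rw [integral_sample_sub hf hF i] at h1
    exact h1.trans (by simp)

lemma integral_batchError (hf : Integrable f ν) (hF : ∫ ξ, f ξ ∂ν = F) {m : ℕ} (hm : 0 < m) :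
    ∫ s, batchError f F s ∂(Measure.pi fun _ : Fin m => ν) = 0 := by
  simp_rw [batchError_eq hm]
  rw [integral_smul, integral_finsetSum _ fun i _ => integrable_sample hf i]
  simp [integral_sample_sub hf hF]

/-- The variance of the average of `m` independent samples. -/
lemma integral_norm_sq_batchError (hf : Integrable f ν) (hF : ∫ ξ, f ξ ∂ν = F)
    (hf2 : Integrable (fun ξ => ‖f ξ - F‖ ^ 2) ν) {m : ℕ} (hm : 0 < m) :
    ∫ s, ‖batchError f F s‖ ^ 2 ∂(Measure.pi fun _ : Fin m => ν)
      = (∫ ξ, ‖f ξ - F‖ ^ 2 ∂ν) / m := by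
  simp_rw [norm_sq_batchError hm]
  rw [integral_const_mul, integral_finsetSum _ fun i _ => integrable_finsetSum _ fun j _ =>
    integrable_inner_sample hf hf2 i j]
  simp_rw [fun i => integral_finsetSum Finset.univ fun j (_ : j ∈ Finset.univ) =>
    integrable_inner_sample hf hf2 i j, integral_inner_sample hf hF]
  have : (m : ℝ) ≠ 0 := by positivity
  simp
  field_simp

/-- Bias-variance decomposition for the average of `m` independent samples. -/
lemma integral_norm_sq_add_batchError (hf : Integrable f ν) (hF : ∫ ξ, f ξ ∂ν = F)
    (hf2 : Integrable (fun ξ => ‖f ξ - F‖ ^ 2) ν) {m : ℕ} (hm : 0 < m) (c : H) :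
    ∫ s, ‖c + batchError f F s‖ ^ 2 ∂(Measure.pi fun _ : Fin m => ν)
      = ‖c‖ ^ 2 + (∫ ξ, ‖f ξ - F‖ ^ 2 ∂ν) / m := by
  simp_rw [norm_add_sq_real]
  have hi : Integrable (fun s : Fin m → Ξ => 2 * inner ℝ c (batchError f F s))
    (Measure.pi fun _ => ν) := ((integrable_batchError hf hm).const_inner c).const_mul 2
  have hi' : Integrable (fun s : Fin m → Ξ => ‖c‖ ^ 2 + 2 * inner ℝ c (batchError f F s))
    (Measure.pi fun _ => ν) := (integrable_const _).add hi
  rw [integral_add hi' (integrable_norm_sq_batchError hf hf2 hm),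
    integral_add (integrable_const _) hi, integral_const_mul, integral_inner
      (integrable_batchError hf hm), integral_batchError hf hF hm,
    integral_norm_sq_batchError hf hF hf2 hm]
  simp

variable {T : Type*} [NormedAddCommGroup T] [InnerProductSpace ℝ T] [CompleteSpace T]
  {g : Ξ → T} {G : T} {σ : ℝ}

/-- The expected value of the bound for one stochastic step from a fixed point. -/
lemma lintegral_batch_le (hf : Integrable f ν) (hF : ∫ ξ, f ξ ∂ν = F) (hg : Integrable g ν)
    (hG : ∫ ξ, g ξ ∂ν = G)
    (hv : ∫⁻ ξ, ENNReal.ofReal (‖f ξ - F‖ ^ 2 + ‖g ξ - G‖ ^ 2) ∂ν ≤ ENNReal.ofReal (σ ^ 2))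
    {m : ℕ} (hm : 0 < m) {α β : ℝ} (hα : 0 ≤ α) (hβ : 0 ≤ β) (a : T) :
    ∫⁻ s, ENNReal.ofReal (α * (‖F + batchError f F s‖ ^ 2
        + (‖a + batchError g G s‖ ^ 2 + ‖batchError g G s‖ ^ 2))
        + β * (‖batchError f F s‖ ^ 2 + ‖batchError g G s‖ ^ 2)) ∂(Measure.pi fun _ : Fin m => ν)
      ≤ ENNReal.ofReal (α * (‖F‖ ^ 2 + ‖a‖ ^ 2 + 2 * (σ ^ 2 / m)) + β * (σ ^ 2 / m)) := by
  obtain ⟨hf2, hg2, hV⟩ := integrable_norm_sq_of_variance_le hf hg hv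
  have i1 := integrable_norm_sq_add_batchError hf hf2 hm F
  have i2 := integrable_norm_sq_add_batchError hg hg2 hm a
  have i3 := integrable_norm_sq_batchError hf hf2 hm
  have i4 := integrable_norm_sq_batchError hg hg2 hm
  have i5 : Integrable (fun s : Fin m → Ξ =>
      ‖a + batchError g G s‖ ^ 2 + ‖batchError g G s‖ ^ 2) (Measure.pi fun _ => ν) := i2.add i4
  have i6 : Integrable (fun s : Fin m → Ξ => α * (‖F + batchError f F s‖ ^ 2
      + (‖a + batchError g G s‖ ^ 2 + ‖batchError g G s‖ ^ 2))) (Measure.pi fun _ => ν) :=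
    (i1.add i5).const_mul α
  have i7 : Integrable (fun s : Fin m → Ξ =>
      β * (‖batchError f F s‖ ^ 2 + ‖batchError g G s‖ ^ 2)) (Measure.pi fun _ => ν) :=
    (i3.add i4).const_mul β
  rw [← ofReal_integral_eq_lintegral_ofReal (i6.fun_add i7)
    (ae_of_all _ fun s => by simp only [Pi.zero_apply]; positivity)]
  refine ENNReal.ofReal_le_ofReal ?_
  rw [integral_add i6 i7, integral_const_mul, integral_const_mul, integral_add i1 i5,
    integral_add i3 i4,
    integral_add i2 i4, integral_norm_sq_add_batchError hf hF hf2 hm,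
    integral_norm_sq_add_batchError hg hG hg2 hm, integral_norm_sq_batchError hf hF hf2 hm,
    integral_norm_sq_batchError hg hG hg2 hm]
  have hm' : (0 : ℝ) < m := by positivity
  -- The variance of `g` is counted twice and that of `f` once; adding the latter once more gives
  -- the uniform bound 2σ²/m.
  have h0 : 0 ≤ (∫ ξ, ‖f ξ - F‖ ^ 2 ∂ν) / m := by positivity
  have hV' : (∫ ξ, ‖f ξ - F‖ ^ 2 ∂ν) / m + (∫ ξ, ‖g ξ - G‖ ^ 2 ∂ν) / m ≤ σ ^ 2 / m := by
    rw [← add_div]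
    gcongr
  refine add_le_add (mul_le_mul_of_nonneg_left ?_ hα) (mul_le_mul_of_nonneg_left hV' hβ)
  linarith

end Batch

/-! ### Integrating out samples independent of the past -/

section Independence

/-- Integration over a batch of independent samples that is independent of the past. -/
lemma lintegral_comp_samples {Ω Ξ Z : Type*} {𝒢 mΩ : MeasurableSpace Ω} [MeasurableSpace Ξ]
    [MeasurableSpace Z] {P : Measure Ω} [IsProbabilityMeasure P] {ν : Measure Ξ}
    [IsProbabilityMeasure ν] {m : ℕ} {S : Fin m → Ω → Ξ} {z : Ω → Z}
    (h𝒢 : 𝒢 ≤ mΩ) (hS : ∀ i, Measurable (S i)) (hlaw : ∀ i, P.map (S i) = ν)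
    (hiid : iIndepFun S P)
    (hind : Indep (⨆ i, MeasurableSpace.comap (S i) inferInstance) 𝒢 P) (hz : Measurable[𝒢] z)
    {X : Z × (Fin m → Ξ) → ℝ≥0∞} (hX : Measurable X) :
    ∫⁻ w, X (z w, fun i => S i w) ∂P
      = ∫⁻ w, ∫⁻ s, X (z w, s) ∂(Measure.pi fun _ => ν) ∂P := by
  have hz' : Measurable z := hz.mono h𝒢 le_rfl
  have hS' : Measurable fun w i => S i w := measurable_pi_lambda _ hS
  have hindep : IndepFun z (fun w i => S i w) P := by
    refine indep_of_indep_of_le_left (indep_of_indep_of_le_right hind.symm ?_) ?_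
    · rw [MeasurableSpace.pi, MeasurableSpace.comap_iSup]
      refine iSup_mono fun i => ?_
      rw [MeasurableSpace.comap_comp]
      rfl
    · exact hz.comap_le
  have hmap := (indepFun_iff_map_prod_eq_prod_map_map hz'.aemeasurable hS'.aemeasurable).1 hindep
  have hpi : P.map (fun w i => S i w) = Measure.pi fun _ => ν := by
    rw [(iIndepFun_iff_map_fun_eq_pi_map fun i => (hS i).aemeasurable).1 hiid]
    simp_rw [hlaw]
  rw [hpi] at hmap
  rw [← lintegral_map hX (hz'.prodMk hS'), hmap, lintegral_prod _ hX.aemeasurable,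
    lintegral_map hX.lintegral_prod_right' hz']

end Independence

/-! ### Measurability of norms of tangent fields -/

section BundleMeasurability

lemma ContinuousOn.measurable_comp_preimage {α X Y : Type*} [MeasurableSpace α]
    [TopologicalSpace X] [MeasurableSpace X] [OpensMeasurableSpace X] [TopologicalSpace Y]
    [MeasurableSpace Y] [BorelSpace Y] {g : X → Y} {U : Set X} (hg : ContinuousOn g U)
    {f : α → X} (hf : Measurable f) : Measurable (fun a : f ⁻¹' U => g (f a)) := by
  have h1 : Measurable (fun a : f ⁻¹' U => (⟨f a, a.2⟩ : U)) :=
    (hf.comp measurable_subtype_coe).subtype_mk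
  exact (continuousOn_iff_continuous_domRestrict.1 hg).measurable.comp h1

variable {d : ℕ} {M : Type*} [MetricSpace M] [ChartedSpace (Euc d) M] [IsManifold (𝓡 d) ∞ M]
  [RiemannianBundle (fun q : M => TangentSpace (𝓡 d) q)]
  [IsContMDiffRiemannianBundle (𝓡 d) ∞ (Euc d) (fun q : M => TangentSpace (𝓡 d) q)]
  [MeasurableSpace M] [BorelSpace M]

/-- Over the base set of a trivialization the combination can be formed in coordinates, and its norm
is continuous in the base point and the coordinates because the metric is continuous. -/
lemma measurable_norm_sum_smul_on_chart {α ι : Type*} [MeasurableSpace α] [Fintype ι] {b : α → M}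
    (hb : Measurable b) {v : ι → (a : α) → TangentSpace (𝓡 d) (b a)}
    (hv : ∀ i, Measurable[inferInstance, borel (TangentBundle (𝓡 d) M)]
      (fun a => (⟨b a, v i a⟩ : TangentBundle (𝓡 d) M))) (c : ι → ℝ)
    (e : Trivialization (Euc d) (TotalSpace.proj : TangentBundle (𝓡 d) M → M))
    [e.IsLinear ℝ] :
    Measurable (fun a : b ⁻¹' e.baseSet => ‖∑ i, c i • v i a.1‖) := by
  have hcoord : ∀ i, Measurable (fun a : b ⁻¹' e.baseSet =>
      (e (⟨b a.1, v i a.1⟩ : TangentBundle (𝓡 d) M)).2) := by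
    intro i
    let mT : MeasurableSpace (TangentBundle (𝓡 d) M) := borel _
    have hT : BorelSpace (TangentBundle (𝓡 d) M) := ⟨rfl⟩
    have hs : b ⁻¹' e.baseSet = (fun a => (⟨b a, v i a⟩ : TangentBundle (𝓡 d) M)) ⁻¹' e.source := by
      ext a
      exact (e.mem_source (x := ⟨b a, v i a⟩)).symm
    rw [hs]
    exact ContinuousOn.measurable_comp_preimage
      (continuous_snd.comp_continuousOn e.continuousOn_toFun) (hv i)
  have hN : ContinuousOn (fun y : M × Euc d => ‖e.symm y.1 y.2‖)
      (e.baseSet ×ˢ (Set.univ : Set (Euc d))) := by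
    have : IsContinuousRiemannianBundle (Euc d) (fun q : M => TangentSpace (𝓡 d) q) := by
      obtain ⟨g, hg, h⟩ := IsContMDiffRiemannianBundle.exists_contMDiff (IB := 𝓡 d) (n := ∞)
        (F := Euc d) (E := fun q : M => TangentSpace (𝓡 d) q)
      exact ⟨g, hg.continuous, h⟩
    have h1 : ContinuousOn (fun y : M × Euc d =>
        TotalSpace.mk' (Euc d) (E := fun q : M => TangentSpace (𝓡 d) q) y.1
          (e.symm y.1 y.2)) (e.baseSet ×ˢ (Set.univ : Set (Euc d))) :=
      e.continuousOn_symm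
    have h2 := h1.inner_bundle h1
    simp_rw [real_inner_self_eq_norm_sq] at h2
    simpa [Real.sqrt_sq] using h2.sqrt
  have hu : Measurable (fun a : b ⁻¹' e.baseSet =>
      (b a.1, ∑ i, c i • (e (⟨b a.1, v i a.1⟩ : TangentBundle (𝓡 d) M)).2)) :=
    (hb.comp measurable_subtype_coe).prodMk
      (Finset.measurable_fun_sum _ fun i _ => (hcoord i).const_smul (c i))
  have hm := (ContinuousOn.measurable_comp_preimage hN hu).comp
    (Measurable.subtype_mk measurable_id (h := fun a => ⟨a.2, trivial⟩))
  convert hm using 2 with a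
  simp only [Function.comp_apply, id]
  congr 1
  rw [← e.symmₗ_apply (R := ℝ) a.2, map_sum]
  refine Finset.sum_congr rfl fun i _ => ?_
  rw [map_smul, e.symmₗ_apply a.2, e.symm_apply_apply_mk a.2]

variable [SecondCountableTopology M]

/-- The norm of a linear combination of measurable fields of tangent vectors over the same map to
the manifold is measurable. -/
lemma measurable_norm_sum_smul {α ι : Type*} [MeasurableSpace α] [Fintype ι] {b : α → M}
    (hb : Measurable b) {v : ι → (a : α) → TangentSpace (𝓡 d) (b a)}
    (hv : ∀ i, Measurable[inferInstance, borel (TangentBundle (𝓡 d) M)]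
      (fun a => (⟨b a, v i a⟩ : TangentBundle (𝓡 d) M))) (c : ι → ℝ) :
    Measurable (fun a => ‖∑ i, c i • v i a‖) := by
  let e := fun p : M => trivializationAt (Euc d) (fun q : M => TangentSpace (𝓡 d) q) p
  -- Second countability reduces to countably many trivializations, so the local statements glue.
  obtain ⟨S, hS, hcov⟩ := TopologicalSpace.countable_cover_nhds
    (f := fun p : M => (e p).baseSet) fun p =>
      (e p).open_baseSet.mem_nhds (FiberBundle.mem_baseSet_trivializationAt' p)
  intro t ht
  have hun : (fun a => ‖∑ i, c i • v i a‖) ⁻¹' t = ⋃ p ∈ S, Subtype.val ''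
      ((fun a : b ⁻¹' (e p).baseSet => ‖∑ i, c i • v i a.1‖) ⁻¹' t) := by
    ext a
    have ha : b a ∈ ⋃ p ∈ S, (e p).baseSet := hcov ▸ Set.mem_univ _
    simp only [Set.mem_iUnion, exists_prop] at ha
    obtain ⟨p, hp, hpa⟩ := ha
    simp only [Set.mem_iUnion, exists_prop]
    exact ⟨fun h => ⟨p, hp, ⟨a, hpa⟩, h, rfl⟩, fun ⟨_, _, _, h, hh⟩ => hh ▸ h⟩
  rw [hun]
  exact MeasurableSet.biUnion hS fun p _ =>
    (hb (e p).open_baseSet.measurableSet).subtype_image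
      (measurable_norm_sum_smul_on_chart hb hv c (e p) ht)

end BundleMeasurability

/-! ### Length of the first step -/

lemma isProjection_of_sub_mem_normalCone {n : ℕ} {E : Set (Euc n)} {v x : Euc n} (hx : x ∈ E)
    (h : v - x ∈ normalCone E x) : IsProjection E v x := by
  refine ⟨hx, fun w hw => ?_⟩
  have h1 := h w hw
  rw [← sq_le_sq₀ (norm_nonneg _) (norm_nonneg _), show v - w = (v - x) - (w - x) by abel,
    norm_sub_sq_real (v - x)]
  nlinarith [sq_nonneg ‖w - x‖]

/-- The length of the first step in terms of the distance to a solution, where `Fs` is the value of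
the operator at the solution `xs`. -/
lemma norm_sq_first_step_le {n : ℕ} {E : Set (Euc n)} (hE : Convex ℝ E) {H : Type*}
    [NormedAddCommGroup H] {L η ρ : ℝ} (hL : 0 < L) (hη : η = 1 / L) {f g : H}
    {x x' xs F Fs G : Euc n} (hx' : IsProjection E (x - η • G) x') (hxs : xs ∈ E)
    (hs : -Fs ∈ normalCone E xs)
    (hl : ‖f‖ ^ 2 + ‖Fs - F‖ ^ 2 ≤ L ^ 2 * (ρ ^ 2 + ‖x - xs‖ ^ 2)) :
    ‖g‖ ^ 2 + ‖η⁻¹ • (x - x')‖ ^ 2 ≤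
      40 / 3 * (L ^ 2 * (ρ ^ 2 + ‖x - xs‖ ^ 2)) + 4 * (‖g - f‖ ^ 2 + ‖G - F‖ ^ 2) := by
  have hη0 : 0 < η := by rw [hη]; positivity
  have hηL : η⁻¹ = L := by rw [hη]; simp
  -- The solution is a fixed point of its own projected step, so nonexpansiveness compares `x'` with
  -- `xs`.
  have hps : IsProjection E (xs - η • Fs) xs := by
    refine isProjection_of_sub_mem_normalCone hxs ?_
    have := smul_mem_normalCone hs hη0.le
    rwa [smul_neg, ← sub_sub_cancel_left xs (η • Fs)] at this
  have h1 := hx'.norm_sub_le hE hps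
  have h2 : ‖x' - xs‖ ≤ ‖x - xs‖ + η * (‖Fs - F‖ + ‖G - F‖) := by
    refine h1.trans ?_
    rw [show x - η • G - (xs - η • Fs) = (x - xs) + η • ((Fs - F) - (G - F)) by module]
    refine (norm_add_le _ _).trans ?_
    rw [norm_smul, Real.norm_of_nonneg hη0.le]
    gcongr
    exact norm_sub_le _ _
  have h3 : ‖η⁻¹ • (x - x')‖ ≤ (2 * (L * ‖x - xs‖) + ‖Fs - F‖) + ‖G - F‖ := by
    rw [norm_smul, hηL, Real.norm_of_nonneg hL.le]
    have h4 : ‖x - x'‖ ≤ ‖x - xs‖ + ‖x' - xs‖ := by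
      rw [show x - x' = (x - xs) - (x' - xs) by abel]
      exact norm_sub_le _ _
    have h5 : L * η = 1 := by rw [hη]; field_simp
    calc L * ‖x - x'‖ ≤ L * (‖x - xs‖ + (‖x - xs‖ + η * (‖Fs - F‖ + ‖G - F‖))) := by
          gcongr; linarith
      _ = 2 * (L * ‖x - xs‖) + (L * η) * (‖Fs - F‖ + ‖G - F‖) := by ring
      _ = _ := by rw [h5]; ring
  have h6 : ‖g‖ ^ 2 ≤ 4 / 3 * ‖f‖ ^ 2 + 4 * ‖g - f‖ ^ 2 := by
    have := norm_sub_sq_le_young f (f - g) (t := 1 / 3) (by norm_num)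
    rw [sub_sub_cancel, norm_sub_rev f g] at this
    linarith
  set A := L * ‖x - xs‖ with hA
  have h7 : ‖η⁻¹ • (x - x')‖ ^ 2 ≤ ((2 * A + ‖Fs - F‖) + ‖G - F‖) ^ 2 := by gcongr
  have h8 : L ^ 2 * (ρ ^ 2 + ‖x - xs‖ ^ 2) = L ^ 2 * ρ ^ 2 + A ^ 2 := by rw [hA]; ring
  rw [h8] at hl ⊢
  -- With D = ‖Fs - F‖, splitting off the noise costs the factors 4/3 and 4, then (2A + D)² ≤ 5(A² +
  -- D²), and `hl` contributes a factor 2: 4/3 · 5 · 2 = 40/3.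
  nlinarith [sq_nonneg (A - 2 * ‖Fs - F‖), sq_nonneg ((2 * A + ‖Fs - F‖) - 3 * ‖G - F‖),
    sq_nonneg (L * ρ), sq_nonneg ‖f‖]

/-! ### Residual after one descent step -/

section Steps

variable {d n : ℕ} {M : Type*} [MetricSpace M] [ChartedSpace (Euc d) M]
  [RiemannianBundle (fun q : M => TangentSpace (𝓡 d) q)] {E : Set (Euc n)}
  {FM : (p : M) → E → TangentSpace (𝓡 d) p} {FT : M → E → Euc n} {μ L : ℝ}

/-- The squared residual `r^tan(p, x)² + ‖F_M(p, x)‖²`. -/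
def sqResidual (FM : (p : M) → E → TangentSpace (𝓡 d) p) (FT : M → E → Euc n) (p : M) (x : E) :
    ℝ :=
  tangentResidual FT p x ^ 2 + ‖FM p x‖ ^ 2

lemma sqResidual_nonneg (p : M) (x : E) : 0 ≤ sqResidual FM FT p x := by
  unfold sqResidual
  positivity

lemma sqResidual_le (hE : Convex ℝ E) {η : ℝ} (hη : 0 < η) {p : M} {x : Euc n} {x' : E}
    {G : Euc n} (hx' : IsProjection E (x - η • G) x') :
    sqResidual FM FT p x' ≤
      ‖FM p x'‖ ^ 2 + ‖FT p x' + η⁻¹ • (x - η • G - (x' : Euc n))‖ ^ 2 := by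
  have := tangentResidual_le (FT := FT) (p := p) (x := x')
    (smul_mem_normalCone (hx'.sub_mem_normalCone hE) (inv_nonneg.2 hη.le))
  have := pow_le_pow_left₀ tangentResidual_nonneg this 2
  unfold sqResidual
  linarith

variable [IsManifold (𝓡 d) ∞ M]

/-- The manifold directions are unconstrained, so -F_M(z*) is an admissible test direction. -/
lemma IsSolution.FM_eq_zero (hexp : GeodesicallyComplete d M) {ps : M} {xs : E}
    (hsol : IsSolution FM FT ps xs) : FM ps xs = 0 := by
  obtain ⟨γ, hγ, hv, -⟩ := exists_isGeodesic_expMap hexp ps (-(FM ps xs))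
  have := hsol γ _ hγ hv xs
  rw [sub_self, inner_zero_right, add_zero, inner_neg_right, Left.nonneg_neg_iff,
    real_inner_self_eq_norm_sq] at this
  have h0 : ‖FM ps xs‖ ^ 2 = 0 := le_antisymm this (sq_nonneg _)
  exact norm_eq_zero.1 (pow_eq_zero_iff two_ne_zero |>.1 h0)

lemma IsSolution.neg_FT_mem_normalCone (hexp : GeodesicallyComplete d M) {ps : M} {xs : E}
    (hsol : IsSolution FM FT ps xs) : -FT ps xs ∈ normalCone E (xs : Euc n) := by
  intro w hw
  obtain ⟨γ, hγ, hv, -⟩ := exists_isGeodesic_expMap hexp ps 0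
  have := hsol γ _ hγ hv ⟨w, hw⟩
  rw [inner_zero_right, zero_add] at this
  rw [inner_neg_left]
  linarith

variable [IsContMDiffRiemannianBundle (𝓡 d) ∞ (Euc d) (fun q : M => TangentSpace (𝓡 d) q)]

/-- The residual after a step of size `1 / L`. -/
lemma IsDescentStep.sqResidual_le_of_first (hexp : GeodesicallyComplete d M)
    (hlog : HasLogarithms d M) (hE : Convex ℝ E) (hL : 0 < L)
    (hmono : GeodesicallyStronglyMonotone μ FM FT) (hlip : GeodesicallyLipschitz L FM FT)
    {ps : M} {xs : E} (hsol : IsSolution FM FT ps xs) {p p' : M} {x x' : E}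
    {gM : TangentSpace (𝓡 d) p} {gT : Euc n} (h : IsDescentStep (1 / L) p x gM gT p' x') :
    sqResidual FM FT p' x' ≤ 60 * (L ^ 2 * (dist p ps ^ 2 + ‖(x : Euc n) - xs‖ ^ 2))
      + 27 * (‖gM - FM p x‖ ^ 2 + ‖gT - FT p x‖ ^ 2) := by
  obtain ⟨rfl, hx'⟩ := h
  obtain ⟨w, hw, -, hl⟩ := exists_transport hexp hmono hlip p (-((1 / L) • gM)) x x'
  obtain ⟨v, hv, hvn⟩ := hlog p ps
  obtain ⟨w0, hw0, -, hl0⟩ := exists_transport hexp hmono hlip p v x xs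
  -- Along the logarithm to the solution, the transported value of F_M vanishes.
  rw [hv, hsol.FM_eq_zero hexp, norm_zero, norm_eq_zero] at hw0
  rw [hw0, zero_sub, norm_neg, hv, hvn, norm_sub_rev (xs : Euc n)] at hl0
  have h1 := sqResidual_le (FM := FM) (FT := FT) (p := expMap p (-((1 / L) • gM))) hE
    (by positivity) hx'
  rw [← hw] at h1
  have h2 := norm_sq_after_first_step_le (G := gT) hL rfl hl
  have h3 := norm_sq_first_step_le hE (g := gM) hL rfl hx' xs.2 (hsol.neg_FT_mem_normalCone hexp)
    hl0
  -- Here 9/2 · 40/3 = 60 and 9/2 · 4 + 9 = 27.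
  linarith

/-- The residual after a step of size `μ / L²`. -/
lemma IsDescentStep.sqResidual_le (hexp : GeodesicallyComplete d M) (hE : Convex ℝ E)
    (hμ : 0 < μ) (hL : 0 < L)
    (hmono : GeodesicallyStronglyMonotone μ FM FT) (hlip : GeodesicallyLipschitz L FM FT)
    {p p' : M} {x x' : E} {gM : TangentSpace (𝓡 d) p} {gT : Euc n}
    (h : IsDescentStep (μ / L ^ 2) p x gM gT p' x') {t : ℝ} (ht : 0 < t) :
    sqResidual FM FT p' x' ≤
      (1 + t) * (1 - (μ / L) ^ 2) * (‖gM‖ ^ 2 + ‖(μ / L ^ 2)⁻¹ • ((x : Euc n) - x')‖ ^ 2)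
        + (1 + 1 / t) * (‖gM - FM p x‖ ^ 2 + ‖gT - FT p x‖ ^ 2) := by
  obtain ⟨rfl, hx'⟩ := h
  obtain ⟨w, hw, hm, hl⟩ := exists_transport hexp hmono hlip p (-((μ / L ^ 2) • gM)) x x'
  have h1 := _root_.sqResidual_le (FM := FM) (FT := FT) (p := expMap p (-((μ / L ^ 2) • gM))) hE
    (by positivity) hx'
  rw [← hw] at h1
  exact h1.trans (norm_sq_after_step_le hμ hL rfl ht hm hl)

/-- If `μ > L`, the space is a single point. -/
lemma sqResidual_eq_zero_of_lt (hexp : GeodesicallyComplete d M) (hL : 0 < L) (hLμ : L < μ)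
    (hmono : GeodesicallyStronglyMonotone μ FM FT) (hlip : GeodesicallyLipschitz L FM FT)
    (p : M) (x : E) : sqResidual FM FT p x = 0 := by
  have key : ∀ (v : TangentSpace (𝓡 d) p) (x' : E), v = 0 ∧ (x' : Euc n) - x = 0 := by
    intro v x'
    obtain ⟨w, -, hm, hl⟩ := exists_transport hexp hmono hlip p v x x'
    set a := w - FM p x
    set b := FT (expMap p v) x' - FT p x
    set e := (x' : Euc n) - x
    -- Nonnegativity of these squares and `hl` give ⟨a, v⟩ + ⟨b, e⟩ ≤ L(‖v‖² + ‖e‖²), against the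
    -- constant μ > L in `hm`.
    have h1 := norm_sub_sq_real a (L • v)
    have h2 := norm_sub_sq_real b (L • e)
    rw [real_inner_smul_right, norm_smul, Real.norm_of_nonneg hL.le] at h1 h2
    have h3 : (μ - L) * (‖v‖ ^ 2 + ‖e‖ ^ 2) ≤ 0 := by
      have : L * ((μ - L) * (‖v‖ ^ 2 + ‖e‖ ^ 2)) ≤ 0 := by
        have h4 := mul_le_mul_of_nonneg_left hm hL.le
        nlinarith [sq_nonneg ‖a - L • v‖, sq_nonneg ‖b - L • e‖]
      nlinarith
    have h5 : ‖v‖ ^ 2 + ‖e‖ ^ 2 ≤ 0 := by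
      by_contra hneg
      push Not at hneg
      nlinarith [mul_pos (sub_pos.2 hLμ) hneg]
    constructor
    · exact norm_eq_zero.1 (pow_eq_zero_iff two_ne_zero |>.1
        (le_antisymm (by nlinarith [sq_nonneg ‖e‖]) (sq_nonneg ‖v‖)))
    · exact norm_eq_zero.1 (pow_eq_zero_iff two_ne_zero |>.1
        (le_antisymm (by nlinarith [sq_nonneg ‖v‖]) (sq_nonneg ‖e‖)))
  have hr : tangentResidual FT p x = 0 := by
    refine le_antisymm ?_ tangentResidual_nonneg
    -- As `E` reduces to `x`, the normal cone is the whole space.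
    refine (tangentResidual_le (c := -FT p x) fun w hw => ?_).trans (by simp)
    rw [(key 0 ⟨w, hw⟩).2, inner_zero_right]
  rw [sqResidual, hr, (key (FM p x) x).1]
  simp

end Steps

/-! ### Deterministic rate -/

section Deterministic

variable {d n : ℕ} {M : Type*} [MetricSpace M] [ChartedSpace (Euc d) M] [IsManifold (𝓡 d) ∞ M]
  [RiemannianBundle (fun q : M => TangentSpace (𝓡 d) q)]
  [IsContMDiffRiemannianBundle (𝓡 d) ∞ (Euc d) (fun q : M => TangentSpace (𝓡 d) q)]
  {E : Set (Euc n)}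
  {FM : (p : M) → E → TangentSpace (𝓡 d) p} {FT : M → E → Euc n} {μ L : ℝ}

lemma IsDescentStep.sqResidual_le_exp (hexp : GeodesicallyComplete d M) (hE : Convex ℝ E)
    (hcl : IsClosed E) (hμ : 0 < μ) (hL : 0 < L)
    (hmono : GeodesicallyStronglyMonotone μ FM FT) (hlip : GeodesicallyLipschitz L FM FT)
    {p p' : M} {x x' : E} (h : IsDescentStep (μ / L ^ 2) p x (FM p x) (FT p x) p' x') :
    sqResidual FM FT p' x' ≤ Real.exp (-((μ / L) ^ 2 / 2)) * sqResidual FM FT p x := by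
  have hη : 0 < μ / L ^ 2 := by positivity
  set s := (μ / L) ^ 2 with hs
  have hs0 : 0 < s := by positivity
  -- The error terms vanish, and t = s/2 is small enough: (1 + s/2)(1 - s) ≤ 1 - s/2. The sign of 1
  -- - s plays no role here.
  have h1 := h.sqResidual_le hexp hE hμ hL hmono hlip (half_pos hs0)
  have h2 := norm_sq_step_le hE hcl hη (F := FT p x) h.2
  have h3 := norm_gradientMapping_le_tangentResidual (FT := FT) (p := p) (x := x) hE hcl
    (half_pos hη)
  have h4 := pow_le_pow_left₀ (norm_nonneg _) h3 2
  rw [sub_self, add_zero, norm_zero] at h2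
  rw [sub_self, sub_self, norm_zero, norm_zero, ← hs] at h1
  set N := ‖FM p x‖ ^ 2 + ‖(μ / L ^ 2)⁻¹ • ((x : Euc n) - x')‖ ^ 2
  have hN : N ≤ sqResidual FM FT p x := by
    unfold sqResidual
    linarith
  have hN0 : 0 ≤ N := by positivity
  have h5 : 1 - s / 2 ≤ Real.exp (-(s / 2)) := by
    have := Real.add_one_le_exp (-(s / 2))
    linarith
  calc sqResidual FM FT p' x' ≤ (1 + s / 2) * (1 - s) * N := by linarith
    _ ≤ Real.exp (-(s / 2)) * N := by
        gcongr
        nlinarith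
    _ ≤ _ := by gcongr

/-- The step of size 1/L only converts distance into residual, so `k + 1` steps contain `k`
contractions. -/
lemma IsDeterministicRun.sqResidual_le (hexp : GeodesicallyComplete d M)
    (hlog : HasLogarithms d M) (hE : Convex ℝ E) (hcl : IsClosed E) (hμ : 0 < μ) (hL : 0 < L)
    (hmono : GeodesicallyStronglyMonotone μ FM FT) (hlip : GeodesicallyLipschitz L FM FT)
    {ps : M} {xs : E} (hsol : IsSolution FM FT ps xs) {p₀ : M} {x₀ : E} {K : ℕ}
    {y : ℕ → M} {x : ℕ → E} (h : IsDeterministicRun FM FT (stepSize μ L) K p₀ x₀ y x)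
    (k : ℕ) (hk : k + 1 ≤ K) :
    sqResidual FM FT (y (k + 1)) (x (k + 1)) ≤ 60 * Real.exp (-((μ / L) ^ 2 * k / 2)) * L ^ 2
      * (dist p₀ ps ^ 2 + ‖(x₀ : Euc n) - xs‖ ^ 2) := by
  induction k with
  | zero =>
    have h0 := h.step 0 hk
    rw [h.init.1, h.init.2, stepSize, if_pos rfl] at h0
    have := h0.sqResidual_le_of_first hexp hlog hE hL hmono hlip hsol
    simp only [sub_self, norm_zero] at this
    simp only [Nat.cast_zero, mul_zero, zero_div, neg_zero, Real.exp_zero]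
    linarith
  | succ k ih =>
    have h0 := h.step (k + 1) hk
    rw [stepSize, if_neg k.succ_ne_zero] at h0
    have h1 := h0.sqResidual_le_exp hexp hE hcl hμ hL hmono hlip
    have h2 : Real.exp (-((μ / L) ^ 2 * ((k + 1 : ℕ) : ℝ) / 2))
        = Real.exp (-((μ / L) ^ 2 / 2)) * Real.exp (-((μ / L) ^ 2 * k / 2)) := by
      rw [← Real.exp_add]
      congr 1
      push_cast
      ring
    have h3 := mul_le_mul_of_nonneg_left (ih (by omega))
      (Real.exp_pos (-((μ / L) ^ 2 / 2))).le
    rw [h2]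
    linarith

end Deterministic

/-! ### Numerical inequalities for the batch sizes -/

section Numeric

/-- The product (1 + s/2)(1 - s) = 1 - s/2 - s²/2 leaves a margin s/2. The noise, amplified by 1 +
2/s, uses 13s/60 < s/4 of it, and its s² terms are absorbed by -s²/2. -/
lemma stochastic_contraction_le {s A V : ℝ} (hs : 0 < s) (hs1 : s ≤ 1) (hA : 0 ≤ A)
    (hV : V ≤ A * s ^ 2 * Real.exp (s / 4) / 12) :
    (1 + s / 2) * (1 - s) * (A + 2 * V) + (1 + 1 / (s / 2)) * V ≤ Real.exp (-(s / 4)) * A := by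
  have he : Real.exp (s / 4) ≤ 13 / 10 := by
    have h1 : Real.exp (s / 4) ≤ Real.exp (1 / 4) := Real.exp_le_exp.2 (by linarith)
    have h2 : Real.exp (1 / 4) ^ 4 = Real.exp 1 := by
      rw [← Real.exp_nat_mul]
      norm_num
    have h3 := Real.exp_one_lt_d9
    have h4 : Real.exp (1 / 4) ≤ 13 / 10 := by
      -- e < 1.3⁴.
      refine le_of_pow_le_pow_left₀ (n := 4) (by norm_num) (by norm_num) ?_
      rw [h2]
      norm_num at h3 ⊢
      linarith
    linarith
  have hV' : V ≤ A * (13 / 120 * s ^ 2) := by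
    have : A * s ^ 2 * Real.exp (s / 4) ≤ A * s ^ 2 * (13 / 10) := by gcongr
    linarith
  have hα : 0 ≤ (1 + s / 2) * (1 - s) := mul_nonneg (by linarith) (by linarith)
  have h1 : (1 + 1 / (s / 2)) * V ≤ A * (13 / 120 * (s ^ 2 + 2 * s)) := by
    calc (1 + 1 / (s / 2)) * V ≤ (1 + 1 / (s / 2)) * (A * (13 / 120 * s ^ 2)) := by gcongr
      _ = _ := by field_simp
  have h2 : (1 + s / 2) * (1 - s) * (A + 2 * V)
      ≤ (1 + s / 2) * (1 - s) * (A + 2 * (A * (13 / 120 * s ^ 2))) := by gcongr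
  have h3 : (1 + s / 2) * (1 - s) * (1 + 2 * (13 / 120 * s ^ 2)) + 13 / 120 * (s ^ 2 + 2 * s)
      ≤ 1 - s / 4 := by
    have : (1 + s / 2) * (1 - s) ≤ 1 := by nlinarith
    have := mul_le_mul_of_nonneg_right this (by positivity : 0 ≤ 2 * (13 / 120 * s ^ 2))
    nlinarith
  have h4 : 1 - s / 4 ≤ Real.exp (-(s / 4)) := by
    have := Real.add_one_le_exp (-(s / 4))
    linarith
  have h5 := mul_le_mul_of_nonneg_right (h3.trans h4) hA
  linarith

lemma variance_le_of_batchBound_zero {μ L σ B : ℝ} {m : ℕ} (hL : 0 < L) (hB : 0 < B)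
    (hm : 0 < m) (h : batchBound μ L σ B 0 ≤ m) : σ ^ 2 / m ≤ L ^ 2 * B ^ 2 := by
  have hm' : (0 : ℝ) < m := by positivity
  rw [batchBound, if_pos rfl, div_le_iff₀ (by positivity)] at h
  rw [div_le_iff₀ hm']
  linarith

/-- The batch bound is the variance condition of `stochastic_contraction_le` solved for `m`, with A
the bound on the residual before step `k + 1`. Its exponent (k + 1) - 2 joins the decay exp(-sk/4)
of A with the slack exp(s/4). -/
lemma variance_le_of_batchBound_succ {μ L σ B : ℝ} {m k : ℕ} (hμ : 0 < μ) (hL : 0 < L)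
    (hB : 0 < B) (hm : 0 < m) (h : batchBound μ L σ B (k + 1) ≤ m) :
    σ ^ 2 / m ≤ 91 * Real.exp (-((μ / L) ^ 2 * k / 4)) * L ^ 2 * B ^ 2 * ((μ / L) ^ 2) ^ 2
      * Real.exp ((μ / L) ^ 2 / 4) / 12 := by
  have hm' : (0 : ℝ) < m := by positivity
  rw [batchBound, if_neg k.succ_ne_zero] at h
  set s := (μ / L) ^ 2 with hs
  have hs0 : 0 < s := by positivity
  have hμs : μ ^ 2 = s * L ^ 2 := by rw [hs]; field_simp
  have h1 : Real.exp (-(s * k / 4)) * Real.exp (s / 4)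
      = (Real.exp (s / 4 * (((k + 1 : ℕ) : ℝ) - 2)))⁻¹ := by
    rw [← Real.exp_neg, ← Real.exp_add]
    congr 1
    push_cast
    ring
  set X := Real.exp (s / 4 * (((k + 1 : ℕ) : ℝ) - 2))
  have hX : 0 < X := Real.exp_pos _
  rw [div_mul_eq_mul_div, div_le_iff₀ (by positivity), hμs] at h
  rw [show 91 * Real.exp (-(s * k / 4)) * L ^ 2 * B ^ 2 * s ^ 2 * Real.exp (s / 4) / 12
    = 91 * L ^ 2 * B ^ 2 * s ^ 2 / 12 * (Real.exp (-(s * k / 4)) * Real.exp (s / 4)) by ring, h1,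
    ← div_eq_mul_inv, div_le_div_iff₀ hm' hX]
  linarith

end Numeric

/-! ### Stochastic rate -/

section Stochastic

variable {d n : ℕ} {M : Type*} [MetricSpace M] [ChartedSpace (Euc d) M] [IsManifold (𝓡 d) ∞ M]
  [RiemannianBundle (fun q : M => TangentSpace (𝓡 d) q)] [MeasurableSpace M] {E : Set (Euc n)}
  {FM : (p : M) → E → TangentSpace (𝓡 d) p} {FT : M → E → Euc n} {μ L : ℝ}
  {Ξ : Type*} [MeasurableSpace Ξ] {ν : Measure Ξ}
  {GM : (p : M) → E → Ξ → TangentSpace (𝓡 d) p} {GT : M → E → Ξ → Euc n} {σ : ℝ}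

/-- A bound for the squared residual after one stochastic step, as a function of the current
iterate `z` and the samples `s`. -/
def stepBound (FM : (p : M) → E → TangentSpace (𝓡 d) p) (FT : M → E → Euc n)
    (GM : (p : M) → E → Ξ → TangentSpace (𝓡 d) p) (GT : M → E → Ξ → Euc n) (h α β : ℝ) {m : ℕ}
    (z : M × E) (s : Fin m → Ξ) : ℝ :=
  α * (‖FM z.1 z.2 + batchError (GM z.1 z.2) (FM z.1 z.2) s‖ ^ 2
      + (‖gradientMapping E h z.2 (FT z.1 z.2) + batchError (GT z.1 z.2) (FT z.1 z.2) s‖ ^ 2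
        + ‖batchError (GT z.1 z.2) (FT z.1 z.2) s‖ ^ 2))
    + β * (‖batchError (GM z.1 z.2) (FM z.1 z.2) s‖ ^ 2
      + ‖batchError (GT z.1 z.2) (FT z.1 z.2) s‖ ^ 2)

/-- The expectation of the bound for one step from a fixed point. -/
lemma IsUnbiasedOracle.lintegral_stepBound_le (hE : Convex ℝ E) (hcl : IsClosed E)
    [IsProbabilityMeasure ν] (ho : IsUnbiasedOracle FM FT ν GM GT σ) {m : ℕ} (hm : 0 < m)
    {h α β : ℝ} (hh : 0 < h) (hα : 0 ≤ α) (hβ : 0 ≤ β) (p : M) (x : E) :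
    ∫⁻ s, ENNReal.ofReal (stepBound FM FT GM GT h α β (p, x) s) ∂(Measure.pi fun _ : Fin m => ν)
      ≤ ENNReal.ofReal α * ENNReal.ofReal (sqResidual FM FT p x)
        + ENNReal.ofReal ((2 * α + β) * (σ ^ 2 / m)) := by
  have : FiniteDimensional ℝ (TangentSpace (𝓡 d) p) :=
    inferInstanceAs (FiniteDimensional ℝ (Euc d))
  have : CompleteSpace (TangentSpace (𝓡 d) p) := FiniteDimensional.complete ℝ _
  have key := lintegral_batch_le (ho.integrable_GM p x) (ho.unbiased_GM p x)
    (ho.integrable_GT p x) (ho.unbiased_GT p x) (ho.variance_le p x) hm hα hβ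
    (gradientMapping E h x (FT p x))
  unfold stepBound
  refine key.trans ?_
  rw [← ENNReal.ofReal_mul hα, ← ENNReal.ofReal_add
    (mul_nonneg hα (sqResidual_nonneg _ _)) (by positivity)]
  refine ENNReal.ofReal_le_ofReal ?_
  have h1 := pow_le_pow_left₀ (norm_nonneg _) (norm_gradientMapping_le_tangentResidual
    (FT := FT) (p := p) (x := x) hE hcl hh) 2
  have h2 : ‖FM p x‖ ^ 2 + ‖gradientMapping E h x (FT p x)‖ ^ 2 ≤ sqResidual FM FT p x := by
    unfold sqResidual
    linarith
  have := mul_le_mul_of_nonneg_left h2 hα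
  linarith

variable [SecondCountableTopology M]
  [IsContMDiffRiemannianBundle (𝓡 d) ∞ (Euc d) (fun q : M => TangentSpace (𝓡 d) q)]
  [BorelSpace M]

lemma IsUnbiasedOracle.measurable_norm_combination (h : IsUnbiasedOracle FM FT ν GM GT σ) {m : ℕ}
    (a b : ℝ) : Measurable (fun y : (M × E) × (Fin m → Ξ) =>
      ‖b • ∑ i, GM y.1.1 y.1.2 (y.2 i) + a • FM y.1.1 y.1.2‖) := by
  -- `none` indexes the exact value F_M and `some i` the i-th answer, all fields over the same base
  -- map.
  have key := measurable_norm_sum_smul (ι := Option (Fin m))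
    (b := fun y : (M × E) × (Fin m → Ξ) => y.1.1) (measurable_fst.comp measurable_fst)
    (v := fun o y => o.elim (FM y.1.1 y.1.2) fun i => GM y.1.1 y.1.2 (y.2 i))
    (fun o => match o with
      | none => h.measurable_FM.comp measurable_fst
      | some i => h.measurable_GM.comp
          (measurable_fst.prodMk ((measurable_pi_apply i).comp measurable_snd)))
    (fun o => o.elim a fun _ => b)
  convert key using 3 with y
  rw [Fintype.sum_option, Finset.smul_sum, add_comm]
  rfl

lemma IsUnbiasedOracle.measurable_stepBound (hE : Convex ℝ E) (hcl : IsClosed E)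
    (hne : E.Nonempty) (ho : IsUnbiasedOracle FM FT ν GM GT σ) (h α β : ℝ) (m : ℕ) :
    Measurable (fun y : (M × E) × (Fin m → Ξ) => stepBound FM FT GM GT h α β y.1 y.2) := by
  have h1 : Measurable (fun y : (M × E) × (Fin m → Ξ) =>
      ‖FM y.1.1 y.1.2 + batchError (GM y.1.1 y.1.2) (FM y.1.1 y.1.2) y.2‖) := by
    convert ho.measurable_norm_combination (m := m) 0 (m : ℝ)⁻¹ using 3 with y
    simp [batchError]
  have h2 : Measurable (fun y : (M × E) × (Fin m → Ξ) =>
      ‖batchError (GM y.1.1 y.1.2) (FM y.1.1 y.1.2) y.2‖) := by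
    convert ho.measurable_norm_combination (m := m) (-1) (m : ℝ)⁻¹ using 3 with y
    rw [batchError, neg_one_smul, sub_eq_add_neg]
  have h3 : Measurable (fun y : (M × E) × (Fin m → Ξ) => FT y.1.1 y.1.2) :=
    ho.measurable_FT.comp measurable_fst
  have h4 : Measurable (fun y : (M × E) × (Fin m → Ξ) =>
      batchError (GT y.1.1 y.1.2) (FT y.1.1 y.1.2) y.2) := by
    have hsum : Measurable (fun y : (M × E) × (Fin m → Ξ) => ∑ i, GT y.1.1 y.1.2 (y.2 i)) :=
      Finset.measurable_fun_sum _ fun i _ => ho.measurable_GT.comp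
        (measurable_fst.prodMk ((measurable_pi_apply i).comp measurable_snd))
    exact (hsum.const_smul (m : ℝ)⁻¹).sub h3
  have h5 : Measurable (fun y : (M × E) × (Fin m → Ξ) =>
      gradientMapping E h y.1.2 (FT y.1.1 y.1.2)) := by
    have hx : Measurable (fun y : (M × E) × (Fin m → Ξ) => (y.1.2 : Euc n)) :=
      measurable_subtype_coe.comp (measurable_snd.comp measurable_fst)
    exact (hx.sub ((continuous_projection hE hcl hne).measurable.comp
      (hx.sub (h3.const_smul h)))).const_smul h⁻¹
  exact (((h1.pow_const 2).add (((h5.add h4).norm.pow_const 2).add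
    (h4.norm.pow_const 2))).const_mul α).add
      (((h2.pow_const 2).add (h4.norm.pow_const 2)).const_mul β)

variable {Ω : Type*} {mΩ : MeasurableSpace Ω} {P : Measure Ω} [IsProbabilityMeasure ν]
  [IsProbabilityMeasure P] {η : ℕ → ℝ} {m : ℕ → ℕ} {K : ℕ} {p₀ : M} {x₀ : E}
  {ℱ : Filtration ℕ mΩ} {S : (k : ℕ) → Fin (m k) → Ω → Ξ} {y : ℕ → Ω → M} {x : ℕ → Ω → E}

/-- The expectation of the bound for one step in terms of the current residual. -/
lemma IsStochasticRun.lintegral_stepBound_le (hE : Convex ℝ E) (hcl : IsClosed E)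
    (ho : IsUnbiasedOracle FM FT ν GM GT σ)
    (hr : IsStochasticRun P ν GM GT η m K p₀ x₀ ℱ S y x) {k : ℕ} (hk : k < K) (hm : 0 < m k)
    {h α β : ℝ} (hh : 0 < h) (hα : 0 ≤ α) (hβ : 0 ≤ β) :
    ∫⁻ w, ENNReal.ofReal (stepBound FM FT GM GT h α β (y k w, x k w) fun i => S k i w) ∂P
      ≤ ENNReal.ofReal α * ∫⁻ w, ENNReal.ofReal (sqResidual FM FT (y k w) (x k w)) ∂P
        + ENNReal.ofReal ((2 * α + β) * (σ ^ 2 / m k)) := by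
  have hmeas := (ho.measurable_stepBound hE hcl ⟨x₀, x₀.2⟩ h α β (m k)).ennreal_ofReal
  have hz : Measurable[ℱ k] (fun w => (y k w, x k w)) :=
    (hr.adapted k hk.le).1.prodMk (hr.adapted k hk.le).2
  rw [lintegral_comp_samples (ℱ.le k) (hr.sample_measurable k hk) (hr.sample_law k hk)
    (hr.sample_iIndep k hk) (hr.sample_indep_past k hk) hz hmeas]
  calc _ ≤ ∫⁻ w, (ENNReal.ofReal α * ENNReal.ofReal (sqResidual FM FT (y k w) (x k w))
          + ENNReal.ofReal ((2 * α + β) * (σ ^ 2 / m k))) ∂P :=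
        lintegral_mono fun w => ho.lintegral_stepBound_le hE hcl hm hh hα hβ (y k w) (x k w)
    _ = _ := by
        rw [lintegral_add_right _ measurable_const, lintegral_const_mul' _ _ ENNReal.ofReal_ne_top]
        simp

/-- The expected squared residual after the first step. -/
lemma IsStochasticRun.lintegral_sqResidual_one_le (hexp : GeodesicallyComplete d M)
    (hlog : HasLogarithms d M) (hE : Convex ℝ E) (hcl : IsClosed E) (hL : 0 < L)
    (hmono : GeodesicallyStronglyMonotone μ FM FT) (hlip : GeodesicallyLipschitz L FM FT)
    {ps : M} {xs : E} (hsol : IsSolution FM FT ps xs) (ho : IsUnbiasedOracle FM FT ν GM GT σ)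
    (hr : IsStochasticRun P ν GM GT (stepSize μ L) m K p₀ x₀ ℱ S y x) (hK : 0 < K)
    (hm : 0 < m 0) {B : ℝ} (hB : 0 < B)
    (hd : dist p₀ ps ^ 2 + ‖(x₀ : Euc n) - xs‖ ^ 2 ≤ B ^ 2)
    (hb : batchBound μ L σ B 0 ≤ m 0) :
    ∫⁻ w, ENNReal.ofReal (sqResidual FM FT (y 1 w) (x 1 w)) ∂P
      ≤ ENNReal.ofReal (91 * L ^ 2 * B ^ 2) := by
  have hV := variance_le_of_batchBound_zero hL hB hm hb
  have hV0 : 0 ≤ σ ^ 2 / m 0 := by positivity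
  -- Only the noise part of `stepBound` is needed: α = 0 makes the step size 1 of the gradient
  -- mapping immaterial, and β = 27. The total is 60 + 27 = 87 ≤ 91.
  calc _ ≤ ∫⁻ w, (ENNReal.ofReal (60 * (L ^ 2 * B ^ 2)) + ENNReal.ofReal
          (stepBound FM FT GM GT 1 0 27 (y 0 w, x 0 w) fun i => S 0 i w)) ∂P := by
        refine lintegral_mono fun w => ?_
        have h1 := hr.step 0 hK w
        rw [stepSize, if_pos rfl] at h1
        have h2 := h1.sqResidual_le_of_first hexp hlog hE hL hmono hlip hsol
        have h3 : 0 ≤ stepBound FM FT GM GT 1 0 27 (y 0 w, x 0 w) fun i => S 0 i w := by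
          unfold stepBound
          positivity
        rw [← ENNReal.ofReal_add (by positivity) h3]
        refine ENNReal.ofReal_le_ofReal ?_
        have h4 : L ^ 2 * (dist p₀ ps ^ 2 + ‖(x₀ : Euc n) - xs‖ ^ 2) ≤ L ^ 2 * B ^ 2 := by gcongr
        rw [← (hr.init w).1, ← (hr.init w).2] at h4
        simp only [stepBound, batchError]
        linarith
    _ = ENNReal.ofReal (60 * (L ^ 2 * B ^ 2)) + ∫⁻ w, ENNReal.ofReal
          (stepBound FM FT GM GT 1 0 27 (y 0 w, x 0 w) fun i => S 0 i w) ∂P := by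
        rw [lintegral_add_left measurable_const]
        simp
    _ ≤ ENNReal.ofReal (60 * (L ^ 2 * B ^ 2))
          + ENNReal.ofReal ((2 * 0 + 27) * (σ ^ 2 / m 0)) := by
        gcongr
        simpa using hr.lintegral_stepBound_le hE hcl ho hK hm (h := 1) (α := 0) (β := 27)
          one_pos le_rfl (by norm_num)
    _ ≤ _ := by
        rw [← ENNReal.ofReal_add (by positivity) (by positivity)]
        refine ENNReal.ofReal_le_ofReal ?_
        nlinarith [mul_pos (pow_pos hL 2) (pow_pos hB 2)]

/-- The expected squared residual after a step of size `μ / L²`. -/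
lemma IsStochasticRun.lintegral_sqResidual_succ_le (hexp : GeodesicallyComplete d M)
    (hE : Convex ℝ E) (hcl : IsClosed E) (hμ : 0 < μ) (hL : 0 < L) (hμL : μ ≤ L)
    (hmono : GeodesicallyStronglyMonotone μ FM FT) (hlip : GeodesicallyLipschitz L FM FT)
    (ho : IsUnbiasedOracle FM FT ν GM GT σ)
    (hr : IsStochasticRun P ν GM GT (stepSize μ L) m K p₀ x₀ ℱ S y x) {k : ℕ} (hk : k + 1 < K)
    (hm : 0 < m (k + 1)) {A : ℝ} (hA : 0 ≤ A)
    (hΨ : ∫⁻ w, ENNReal.ofReal (sqResidual FM FT (y (k + 1) w) (x (k + 1) w)) ∂P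
      ≤ ENNReal.ofReal A)
    (hV : σ ^ 2 / m (k + 1) ≤ A * ((μ / L) ^ 2) ^ 2 * Real.exp ((μ / L) ^ 2 / 4) / 12) :
    ∫⁻ w, ENNReal.ofReal (sqResidual FM FT (y (k + 2) w) (x (k + 2) w)) ∂P
      ≤ ENNReal.ofReal (Real.exp (-((μ / L) ^ 2 / 4)) * A) := by
  have hη : 0 < μ / L ^ 2 := by positivity
  set s := (μ / L) ^ 2 with hs
  have hs0 : 0 < s := by positivity
  have hs1 : s ≤ 1 := pow_le_one₀ (by positivity) ((div_le_one hL).2 hμL)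
  -- This is where μ ≤ L matters: the coefficient multiplies upper bounds, so it must be
  -- nonnegative.
  have hα : 0 ≤ (1 + s / 2) * (1 - s) := mul_nonneg (by linarith) (by linarith)
  have hβ : 0 ≤ 1 + 1 / (s / 2) := by positivity
  have hV0 : 0 ≤ σ ^ 2 / m (k + 1) := by positivity
  calc _ ≤ ∫⁻ w, ENNReal.ofReal (stepBound FM FT GM GT (μ / L ^ 2 / 2) ((1 + s / 2) * (1 - s))
          (1 + 1 / (s / 2)) (y (k + 1) w, x (k + 1) w) fun i => S (k + 1) i w) ∂P := by
        refine lintegral_mono fun w => ENNReal.ofReal_le_ofReal ?_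
        have h1 := hr.step (k + 1) hk w
        rw [stepSize, if_neg k.succ_ne_zero] at h1
        have h2 := h1.sqResidual_le hexp hE hμ hL hmono hlip (half_pos hs0)
        refine h2.trans ?_
        have h3 := norm_sq_step_le hE hcl hη (F := FT (y (k + 1) w) (x (k + 1) w)) h1.2
        have h4 := mul_le_mul_of_nonneg_left h3 hα
        rw [← hs]
        simp only [stepBound, batchError, add_sub_cancel]
        linarith
    _ ≤ ENNReal.ofReal ((1 + s / 2) * (1 - s)) * ENNReal.ofReal A
          + ENNReal.ofReal ((2 * ((1 + s / 2) * (1 - s)) + (1 + 1 / (s / 2)))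
            * (σ ^ 2 / m (k + 1))) := by
        refine (hr.lintegral_stepBound_le hE hcl ho hk hm (half_pos hη) hα hβ).trans ?_
        gcongr
    _ ≤ _ := by
        rw [← ENNReal.ofReal_mul hα, ← ENNReal.ofReal_add (by positivity) (by positivity)]
        refine ENNReal.ofReal_le_ofReal ?_
        have := stochastic_contraction_le hs0 hs1 hA hV
        linarith

lemma IsStochasticRun.lintegral_sqResidual_le (hexp : GeodesicallyComplete d M)
    (hlog : HasLogarithms d M) (hE : Convex ℝ E) (hcl : IsClosed E) (hμ : 0 < μ) (hL : 0 < L)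
    (hμL : μ ≤ L)
    (hmono : GeodesicallyStronglyMonotone μ FM FT) (hlip : GeodesicallyLipschitz L FM FT)
    {ps : M} {xs : E} (hsol : IsSolution FM FT ps xs) (ho : IsUnbiasedOracle FM FT ν GM GT σ)
    (hr : IsStochasticRun P ν GM GT (stepSize μ L) m K p₀ x₀ ℱ S y x)
    {B : ℝ} (hB : 0 < B) (hd : dist p₀ ps ^ 2 + ‖(x₀ : Euc n) - xs‖ ^ 2 ≤ B ^ 2)
    (hm : ∀ k < K, 0 < m k ∧ batchBound μ L σ B k ≤ m k) (k : ℕ) (hk : k + 1 ≤ K) :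
    ∫⁻ w, ENNReal.ofReal (sqResidual FM FT (y (k + 1) w) (x (k + 1) w)) ∂P
      ≤ ENNReal.ofReal (91 * Real.exp (-((μ / L) ^ 2 * k / 4)) * L ^ 2 * B ^ 2) := by
  induction k with
  | zero =>
    simpa using hr.lintegral_sqResidual_one_le hexp hlog hE hcl hL hmono hlip hsol ho hk
      (hm 0 hk).1 hB hd (hm 0 hk).2
  | succ k ih =>
    refine (hr.lintegral_sqResidual_succ_le hexp hE hcl hμ hL hμL hmono hlip ho hk (hm _ hk).1
      (by positivity) (ih (by omega))
      (variance_le_of_batchBound_succ hμ hL hB (hm _ hk).1 (hm _ hk).2)).trans_eq ?_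
    congr 1
    have h2 : Real.exp (-((μ / L) ^ 2 * ((k + 1 : ℕ) : ℝ) / 4))
        = Real.exp (-((μ / L) ^ 2 / 4)) * Real.exp (-((μ / L) ^ 2 * k / 4)) := by
      rw [← Real.exp_add]
      congr 1
      push_cast
      ring
    rw [h2]
    ring

end Stochastic

end

theorem mainTheorem1 {d n : ℕ} {M : Type*} [MetricSpace M] [ChartedSpace (Euc d) M]
    [IsManifold (𝓡 d) ∞ M] [SecondCountableTopology M]
    [RiemannianBundle (fun q : M => TangentSpace (𝓡 d) q)]
    [IsContMDiffRiemannianBundle (𝓡 d) ∞ (Euc d) (fun q : M => TangentSpace (𝓡 d) q)]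
    [IsRiemannianManifold (𝓡 d) M] [MeasurableSpace M] [BorelSpace M]
    (hexp : GeodesicallyComplete d M) (hlog : HasLogarithms d M)
    (E : Set (Euc n)) (hE_convex : Convex ℝ E) (hE_closed : IsClosed E)
    (FM : (p : M) → E → TangentSpace (𝓡 d) p) (FT : M → E → Euc n)
    (μ L : ℝ) (hμ : 0 < μ) (hL : 0 < L)
    (hmono : GeodesicallyStronglyMonotone μ FM FT) (hlip : GeodesicallyLipschitz L FM FT)
    (ps : M) (xs : E) (hsol : IsSolution FM FT ps xs) (p₀ : M) (x₀ : E)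
    (K : ℕ) (hK : 1 ≤ K) :
    (∀ (y : ℕ → M) (x : ℕ → E),
      IsDeterministicRun FM FT (stepSize μ L) K p₀ x₀ y x →
        tangentResidual FT (y K) (x K) ^ 2 + ‖FM (y K) (x K)‖ ^ 2
          ≤ 66 * Real.exp (-((μ / L) ^ 2 * ((K : ℝ) - 1) / 2)) * L ^ 2
            * (dist p₀ ps ^ 2 + ‖(x₀ : Euc n) - xs‖ ^ 2)) ∧
    (∀ {Ξ Ω : Type*} [MeasurableSpace Ξ] {mΩ : MeasurableSpace Ω}
      (ν : Measure Ξ) (P : Measure Ω) [IsProbabilityMeasure ν] [IsProbabilityMeasure P]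
      (GM : (p : M) → E → Ξ → TangentSpace (𝓡 d) p) (GT : M → E → Ξ → Euc n) (σ B : ℝ),
      IsUnbiasedOracle FM FT ν GM GT σ → 0 < B →
      dist p₀ ps ^ 2 + ‖(x₀ : Euc n) - xs‖ ^ 2 ≤ B ^ 2 →
      ∀ (m : ℕ → ℕ), (∀ k < K, 0 < m k ∧ batchBound μ L σ B k ≤ (m k : ℝ)) →
      ∀ (ℱ : Filtration ℕ mΩ) (S : (k : ℕ) → Fin (m k) → Ω → Ξ)
        (y : ℕ → Ω → M) (x : ℕ → Ω → E),
        IsStochasticRun P ν GM GT (stepSize μ L) m K p₀ x₀ ℱ S y x →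
        ∫⁻ w, ENNReal.ofReal
            (tangentResidual FT (y K w) (x K w) ^ 2 + ‖FM (y K w) (x K w)‖ ^ 2) ∂P
          ≤ ENNReal.ofReal (91 * Real.exp (-((μ / L) ^ 2 * ((K : ℝ) - 1) / 4)) * L ^ 2 * B ^ 2)) := by
  have hlast : ((K - 1 : ℕ) : ℝ) = (K : ℝ) - 1 := by
    rw [Nat.cast_sub hK, Nat.cast_one]
  refine ⟨fun y x hrun => ?_, ?_⟩
  · have h := hrun.sqResidual_le hexp hlog hE_convex hE_closed hμ hL hmono hlip hsol (K - 1)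
      (by omega)
    rw [Nat.sub_add_cancel hK, hlast, sqResidual] at h
    refine h.trans ?_
    gcongr
    norm_num
  · intro Ξ Ω _ mΩ ν P _ _ GM GT σ B ho hB hd m hm ℱ S y x hr
    -- For μ > L the residual vanishes identically; otherwise κ ≤ 1, as the contraction requires.
    rcases lt_or_ge L μ with hLμ | hLμ
    · have h0 : ∀ w, tangentResidual FT (y K w) (x K w) ^ 2 + ‖FM (y K w) (x K w)‖ ^ 2 = 0 :=
        fun w => sqResidual_eq_zero_of_lt hexp hL hLμ hmono hlip (y K w) (x K w)
      simp [h0]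
    · have h := hr.lintegral_sqResidual_le hexp hlog hE_convex hE_closed hμ hL hLμ hmono hlip hsol
        ho hB hd hm (K - 1) (by omega)
      rw [Nat.sub_add_cancel hK, hlast] at h
      exact h
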